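/- A *symmetric space* is a Banach space $E$ of (classes of) measurable real functions on $[0,1]$ such that: if $x\in E$ and $|y|\le|x|$ a.e., then $y\in E$ and $\|y\|_E\le\|x\|_E$; if $x\in E$ and $|y|$ is equimeasurable with $|x|$, then $y\in E$ and $\|y\|_E=\|x\|_E$; and $\chi_{[0,1]}\in E$ with $\|\chi_{[0,1]}\|_E=1$. Let $E,F$ be symmetric spaces such that $F$ is absolutely continuously included in $E$, i.e. $F\subset E$ with $\|x\|_E\le C\|x\|_F$ for all $x\in F$ and some constant $C$, and $$\lim_{\tau\to0+}\ \sup\{\|x\chi_e\|_E/\|x\|_F:\ x\in F,\ x\ne0,\ \operatorname{mes}(e)=\tau\}=0 .$$ Let $W$ be a real Banach space with an unconditional basis $(w_i)_{i<\omega}$ which is seminormalized, i.e. $0<\inf_i\|w_i\|\le\sup_i\|w_i\|<\infty$. Let $(a_i)$, $(b_i)$ be sequences of positive reals, $(a_i)$ non-decreasing with $a_i\to\infty$, $(b_i)$ non-increasing with $\sum_i b_i<\infty$. For $a,b>0$ and $f\in E+F$ put $$k(f;a,b)=\inf\{a\|u\|_E+b\|v\|_F:\ u\in E,\ v\in F,\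 u+v=f\}.$$ The Peetre space $K=K(E,F;W)$ is the space of all $f\in E+F$ such that the series $\sum_i k(f;a_i,b_i)w_i$ converges in $W$, with the norm $$\|f\|_K=\Big|\Big|\Big|\sum_i k(f;a_i,b_i)w_i\Big|\Big|\Big|\ \Big/\ \Big|\Big|\Big|\sum_i k(\chi_{[0,1]};a_i,b_i)w_i\Big|\Big|\Big| ,$$ where $|||\sum_i c_iw_i|||=\sup\{\|\sum_{i\in A}\theta_ic_iw_i\|_W:\ A\subset\mathbb N\text{ finite},\ \theta_i\in[-1,1]\}$ is the usual equivalent norm on $W$ for which the basis is $1$-unconditional (it is the norm of $W$ if the basis already is $1$-unconditional). If $W$ is reflexive, then $K$ is reflexive. If $W$ is weakly sequentially complete, then $K$ is weakly sequentially complete. -/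

import Mathlib

open MeasureTheory Filter Topology Set
open scoped ENNReal NNReal unitInterval

noncomputable section

set_option linter.unusedSectionVars false

/-- Classes (modulo equality a.e.) of Lebesgue measurable real functions on `[0,1]`. -/
abbrev MeasFun : Type := I →ₘ[(volume : Measure I)] ℝ

namespace MeasFun

/-- Two functions on `[0,1]` are equimeasurable if they have the same distribution function. -/
def Equimeasurable (x y : MeasFun) : Prop :=
  ∀ c : ℝ, volume {t : I | c < x t} = volume {t : I | c < y t}

/-- The product `x χ_e` of a function with the indicator function of a measurable set. -/
def cut (x : MeasFun) (e : Set I) (he : MeasurableSet e) : MeasFun :=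
  AEEqFun.mk (e.indicator x) (x.aestronglyMeasurable.indicator he)

end MeasFun

/-- A symmetric Banach function space `E` on `[0,1]`.  It is encoded by the extended norm
`enorm : MeasFun → [0,∞]`, which is the norm on `E` and `∞` off `E`, so that
`E = {x | enorm x < ∞}`.  The fields say that this set is a Banach space under the norm, that it is
solid and rearrangement invariant, and that the indicator function of `[0,1]` has norm one. -/
structure SymmetricSpace where
  enorm : MeasFun → ℝ≥0∞
  enorm_eq_zero : ∀ x, enorm x = 0 → x = 0
  enorm_smul : ∀ (c : ℝ) (x : MeasFun), enorm (c • x) = ENNReal.ofReal |c| * enorm x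
  enorm_add_le : ∀ x y, enorm (x + y) ≤ enorm x + enorm y
  complete : ∀ u : ℕ → MeasFun, (∀ n, enorm (u n) < ∞) →
    (∀ ε : ℝ≥0∞, 0 < ε → ∃ N, ∀ m ≥ N, ∀ n ≥ N, enorm (u m - u n) < ε) →
    ∃ x, enorm x < ∞ ∧ Tendsto (fun n => enorm (u n - x)) atTop (𝓝 0)
  solid : ∀ x y : MeasFun, enorm x < ∞ → |y| ≤ |x| → enorm y ≤ enorm x
  symmetric : ∀ x y : MeasFun, enorm x < ∞ → MeasFun.Equimeasurable |y| |x| → enorm y = enorm x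
  enorm_one : enorm 1 = 1

namespace SymmetricSpace

/-- `F ⊂ᶜ E`: continuous inclusion of `F` into `E`. -/
def ContIncluded (F E : SymmetricSpace) : Prop :=
  ∃ C : ℝ≥0, ∀ x, F.enorm x < ∞ → E.enorm x ≤ C * F.enorm x

/-- `η(τ) = sup {‖x χ_e‖_E / ‖x‖_F : x ∈ F, ‖x‖_F ≠ 0, mes e = τ}` for the inclusion of `F`
into `E`. -/
def eta (F E : SymmetricSpace) (τ : ℝ) : ℝ≥0∞ :=
  ⨆ (x : MeasFun) (_ : F.enorm x ≠ 0 ∧ F.enorm x < ∞) (e : Set I) (he : MeasurableSet e)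
    (_ : volume e = ENNReal.ofReal τ), E.enorm (x.cut e he) / F.enorm x

/-- `F ⋐ E`: absolutely continuous inclusion of `F` into `E`. -/
def AbsContIncluded (F E : SymmetricSpace) : Prop :=
  F.ContIncluded E ∧ Tendsto (F.eta E) (𝓝[>] 0) (𝓝 0)

/-- `k(f;a,b) = inf {a ‖u‖_E + b ‖v‖_F : u + v = f}`, with value `∞` iff `f ∉ E + F`. -/
def kFun (E F : SymmetricSpace) (a b : ℝ) (f : MeasFun) : ℝ≥0∞ :=
  ⨅ (u : MeasFun) (v : MeasFun) (_ : u + v = f),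
    ENNReal.ofReal a * E.enorm u + ENNReal.ofReal b * F.enorm v

lemma enorm_zero (E : SymmetricSpace) : E.enorm 0 = 0 := by
  simpa using E.enorm_smul 0 0

lemma one_ne_zero (E : SymmetricSpace) : (1 : MeasFun) ≠ 0 := by
  intro h
  have h1 := E.enorm_one
  rw [h, E.enorm_zero] at h1
  exact zero_ne_one h1

lemma kFun_le (E F : SymmetricSpace) (a b : ℝ) (u v : MeasFun) :
    E.kFun F a b (u + v) ≤ ENNReal.ofReal a * E.enorm u + ENNReal.ofReal b * F.enorm v :=
  iInf_le_of_le u (iInf_le_of_le v (iInf_le_of_le rfl le_rfl))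

lemma kFun_add_le (E F : SymmetricSpace) (a b : ℝ) (f g : MeasFun) :
    E.kFun F a b (f + g) ≤ E.kFun F a b f + E.kFun F a b g := by
  refine le_of_forall_gt fun r hr => ?_
  obtain ⟨p, hp, q, hq, hpq⟩ : ∃ p, E.kFun F a b f < p ∧ ∃ q, E.kFun F a b g < q ∧ p + q ≤ r := by
    obtain ⟨s, hs, hsr⟩ := exists_between hr
    have hs' : s ≠ ∞ := (hsr.trans_le le_top).ne
    have h1 : E.kFun F a b f + E.kFun F a b g ≠ ∞ := (hs.trans_le le_top).ne
    have h2 := ENNReal.add_ne_top.1 h1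
    have hd : (s - (E.kFun F a b f + E.kFun F a b g)) / 2 ≠ 0 := by
      have h3 := (tsub_pos_of_lt hs).ne'
      exact (ENNReal.div_pos h3 (by simp)).ne'
    refine ⟨_, ENNReal.lt_add_right h2.1 hd, _, ENNReal.lt_add_right h2.2 hd, ?_⟩
    rw [add_add_add_comm, ENNReal.add_halves, add_tsub_cancel_of_le hs.le]
    exact hsr.le
  simp only [kFun, iInf_lt_iff] at hp hq
  obtain ⟨u, v, rfl, h1⟩ := hp
  obtain ⟨u', v', rfl, h2⟩ := hq
  refine lt_of_lt_of_le ?_ hpq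
  refine lt_of_le_of_lt ?_ (ENNReal.add_lt_add h1 h2)
  rw [add_add_add_comm u v u' v']
  refine (kFun_le E F a b _ _).trans ?_
  calc _ ≤ ENNReal.ofReal a * (E.enorm u + E.enorm u') +
        ENNReal.ofReal b * (F.enorm v + F.enorm v') := by
        gcongr
        · exact E.enorm_add_le _ _
        · exact F.enorm_add_le _ _
    _ = _ := by ring

lemma kFun_smul_le (E F : SymmetricSpace) (a b : ℝ) (c : ℝ) (f : MeasFun) :
    E.kFun F a b (c • f) ≤ ENNReal.ofReal |c| * E.kFun F a b f := by
  refine le_of_forall_gt fun r hr => ?_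
  by_cases hc : c = 0
  · subst hc
    have := kFun_le E F a b 0 0
    simp only [add_zero, enorm_zero, mul_zero, nonpos_iff_eq_zero] at this
    simpa [this] using hr
  have hc' : ENNReal.ofReal |c| ≠ 0 := by simpa using hc
  have h : E.kFun F a b f < r / ENNReal.ofReal |c| := by
    rw [ENNReal.lt_div_iff_mul_lt (Or.inl hc') (Or.inl ENNReal.ofReal_ne_top), mul_comm]
    exact hr
  simp only [kFun, iInf_lt_iff] at h
  obtain ⟨u, v, rfl, h1⟩ := h
  rw [ENNReal.lt_div_iff_mul_lt (Or.inl hc') (Or.inl ENNReal.ofReal_ne_top)] at h1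
  rw [smul_add]
  refine (kFun_le E F a b _ _).trans_lt (lt_of_eq_of_lt ?_ h1)
  rw [E.enorm_smul, F.enorm_smul]
  ring

lemma kFun_smul (E F : SymmetricSpace) (a b : ℝ) (c : ℝ) (f : MeasFun) :
    E.kFun F a b (c • f) = ENNReal.ofReal |c| * E.kFun F a b f := by
  refine le_antisymm (kFun_smul_le E F a b c f) ?_
  by_cases hc : c = 0
  · simp [hc]
  have := kFun_smul_le E F a b c⁻¹ (c • f)
  rw [smul_smul, inv_mul_cancel₀ hc, one_smul] at this
  calc _ ≤ ENNReal.ofReal |c| * (ENNReal.ofReal |c⁻¹| * E.kFun F a b (c • f)) := by gcongr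
    _ = _ := by
      rw [← mul_assoc, ← ENNReal.ofReal_mul (abs_nonneg _), ← abs_mul, mul_inv_cancel₀ hc]
      simp

lemma kFun_eq_zero {E F : SymmetricSpace} (h : F.ContIncluded E) {a b : ℝ} (ha : 0 < a)
    (hb : 0 < b) {f : MeasFun} (hf : E.kFun F a b f = 0) : f = 0 := by
  obtain ⟨C, hC⟩ := h
  apply E.enorm_eq_zero
  by_contra hne
  set m : ℝ≥0∞ := 1 / ENNReal.ofReal a + C / ENNReal.ofReal b with hm
  have ha' : ENNReal.ofReal a ≠ 0 := by simpa using ha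
  have hb' : ENNReal.ofReal b ≠ 0 := by simpa using hb
  have hmt : m ≠ ∞ := by
    simp [hm, ENNReal.div_eq_top, ha', hb']
  have key : E.enorm f ≤ m * E.kFun F a b f := by
    refine le_of_forall_gt fun r hr => ?_
    have h0 : E.kFun F a b f < r / m := by
      rw [hf]
      refine ENNReal.div_pos ?_ hmt
      rintro rfl
      exact not_lt_zero hr
    have hm0 : m ≠ 0 := by simp [hm]
    simp only [kFun, iInf_lt_iff] at h0
    obtain ⟨u, v, rfl, h1⟩ := h0
    rw [ENNReal.lt_div_iff_mul_lt (Or.inl hm0) (Or.inl hmt)] at h1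
    refine lt_of_le_of_lt ?_ h1
    have hv : E.enorm v ≤ C / ENNReal.ofReal b * (ENNReal.ofReal b * F.enorm v) := by
      rw [← mul_assoc, ENNReal.div_mul_cancel hb' ENNReal.ofReal_ne_top]
      by_cases hv : F.enorm v < ∞
      · exact hC v hv
      · have htop : F.enorm v = ∞ := by simpa using hv
        exfalso
        rw [htop, ENNReal.mul_top hb', add_top, ENNReal.top_mul hm0] at h1
        exact not_top_lt h1
    have hu : E.enorm u = 1 / ENNReal.ofReal a * (ENNReal.ofReal a * E.enorm u) := by
      rw [← mul_assoc, ENNReal.div_mul_cancel ha' ENNReal.ofReal_ne_top, one_mul]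
    calc E.enorm (u + v) ≤ E.enorm u + E.enorm v := E.enorm_add_le _ _
      _ ≤ 1 / ENNReal.ofReal a * (ENNReal.ofReal a * E.enorm u) +
          C / ENNReal.ofReal b * (ENNReal.ofReal b * F.enorm v) := add_le_add hu.le hv
      _ ≤ m * (ENNReal.ofReal a * E.enorm u + ENNReal.ofReal b * F.enorm v) +
          0 := by
        rw [add_zero, mul_add]
        refine add_le_add (mul_le_mul_left ?_ _) (mul_le_mul_left ?_ _)
        · exact le_self_add
        · exact le_add_self
      _ = _ := by rw [add_zero, mul_comm]
  rw [hf, mul_zero] at key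
  exact hne (le_antisymm key zero_le)

end SymmetricSpace

section Unconditional

variable {W : Type*} [NormedAddCommGroup W] [NormedSpace ℝ W]

/-- For a scalar sequence `c`, the number `sup ‖∑ θᵢ cᵢ wᵢ‖` over all finitely supported choices of
multipliers `θᵢ ∈ [-1,1]`: the norm of `∑ cᵢ wᵢ` in the usual equivalent renorming of `W` that makes
the unconditional basis `w` 1-unconditional.  If `w` is already 1-unconditional, it is
`‖∑ cᵢ wᵢ‖` itself. -/
def unconditionalNorm (w : UnconditionalSchauderBasis ℕ ℝ W) (c : ℕ → ℝ) : ℝ :=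
  ⨆ p : Finset ℕ × (ℕ → Icc (-1 : ℝ) 1), ‖∑ i ∈ p.1, ((p.2 i : ℝ) * c i) • w i‖

instance nonempty_Icc_neg_one_one : Nonempty (Icc (-1 : ℝ) 1) := ⟨⟨0, by norm_num⟩⟩

lemma norm_theta_sum_le {x : ℕ → W} {M : ℝ} (hM : ∀ A : Finset ℕ, ‖∑ i ∈ A, x i‖ ≤ M)
    (A : Finset ℕ) (θ : ℕ → Icc (-1 : ℝ) 1) : ‖∑ i ∈ A, (θ i : ℝ) • x i‖ ≤ 2 * M := by
  classical
  obtain ⟨φ, hφ, hφx⟩ := exists_dual_vector'' ℝ (∑ i ∈ A, (θ i : ℝ) • x i)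
  have hb : ∀ B : Finset ℕ, |∑ i ∈ B, φ (x i)| ≤ M := by
    intro B
    rw [← map_sum, ← Real.norm_eq_abs]
    refine (φ.le_of_opNorm_le hφ _).trans ?_
    simpa using hM B
  have h1 : ‖∑ i ∈ A, (θ i : ℝ) • x i‖ = ∑ i ∈ A, (θ i : ℝ) * φ (x i) := by
    have : φ (∑ i ∈ A, (θ i : ℝ) • x i) = ‖∑ i ∈ A, (θ i : ℝ) • x i‖ := by simpa using hφx
    rw [← this, map_sum]
    simp
  rw [h1]
  calc ∑ i ∈ A, (θ i : ℝ) * φ (x i) ≤ ∑ i ∈ A, |φ (x i)| := by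
        refine Finset.sum_le_sum fun i _ => ?_
        refine (le_abs_self _).trans ?_
        rw [abs_mul]
        have : |(θ i : ℝ)| ≤ 1 := abs_le.2 (θ i).2
        nlinarith [abs_nonneg (φ (x i))]
    _ = ∑ i ∈ A with 0 ≤ φ (x i), |φ (x i)| + ∑ i ∈ A with ¬ 0 ≤ φ (x i), |φ (x i)| :=
        (Finset.sum_filter_add_sum_filter_not _ _ _).symm
    _ = ∑ i ∈ A with 0 ≤ φ (x i), φ (x i) + -∑ i ∈ A with ¬ 0 ≤ φ (x i), φ (x i) := by
        rw [← Finset.sum_neg_distrib]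
        congr 1
        · exact Finset.sum_congr rfl fun i hi => abs_of_nonneg (Finset.mem_filter.1 hi).2
        · exact Finset.sum_congr rfl fun i hi =>
            abs_of_neg (not_le.1 (Finset.mem_filter.1 hi).2)
    _ ≤ 2 * M := by
        have h2 := (abs_le.1 (hb (A.filter fun i => 0 ≤ φ (x i)))).2
        have h3 := (abs_le.1 (hb (A.filter fun i => ¬ 0 ≤ φ (x i)))).1
        linarith

variable [CompleteSpace W] (w : UnconditionalSchauderBasis ℕ ℝ W)

lemma exists_theta_bound : ∃ C : ℝ, ∀ c : ℕ → ℝ, Summable (fun i => c i • w i) →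
    ∀ p : Finset ℕ × (ℕ → Icc (-1 : ℝ) 1),
      ‖∑ i ∈ p.1, ((p.2 i : ℝ) * c i) • w i‖ ≤ C * ‖∑' i, c i • w i‖ := by
  obtain ⟨C, hC⟩ := w.exists_norm_proj_le
  refine ⟨2 * C, fun c hc p => ?_⟩
  have hcoord : ∀ i, w.coord i (∑' j, c j • w j) = c i := by
    intro i
    rw [(w.coord i).map_tsum hc]
    rw [tsum_eq_single i]
    · simp [w.ortho]
    · intro j hj
      simp [w.ortho, hj.symm]
  have := norm_theta_sum_le (x := fun i => c i • w i) (M := C * ‖∑' i, c i • w i‖)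
    (fun A => by
      have h := (w.proj A).le_of_opNorm_le (hC A) (∑' i, c i • w i)
      simpa [hcoord] using h) p.1 p.2
  simpa [smul_smul, mul_assoc] using this

variable {w}

lemma bddAbove_theta {c : ℕ → ℝ} (hc : Summable (fun i => c i • w i)) :
    BddAbove (range fun p : Finset ℕ × (ℕ → Icc (-1 : ℝ) 1) =>
      ‖∑ i ∈ p.1, ((p.2 i : ℝ) * c i) • w i‖) := by
  obtain ⟨C, hC⟩ := exists_theta_bound w
  exact ⟨_, by rintro _ ⟨p, rfl⟩; exact hC c hc p⟩

lemma le_unconditionalNorm {c : ℕ → ℝ} (hc : Summable (fun i => c i • w i)) (A : Finset ℕ)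
    (θ : ℕ → Icc (-1 : ℝ) 1) :
    ‖∑ i ∈ A, ((θ i : ℝ) * c i) • w i‖ ≤ unconditionalNorm w c :=
  le_ciSup (bddAbove_theta hc) (A, θ)

lemma unconditionalNorm_nonneg (c : ℕ → ℝ) : 0 ≤ unconditionalNorm w c :=
  Real.iSup_nonneg fun _ => norm_nonneg _

lemma norm_sum_le_unconditionalNorm {c : ℕ → ℝ} (hc : Summable (fun i => c i • w i))
    (A : Finset ℕ) : ‖∑ i ∈ A, c i • w i‖ ≤ unconditionalNorm w c := by
  simpa using le_unconditionalNorm hc A (fun _ => ⟨1, by norm_num⟩)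

lemma norm_tsum_le_unconditionalNorm {c : ℕ → ℝ} (hc : Summable (fun i => c i • w i)) :
    ‖∑' i, c i • w i‖ ≤ unconditionalNorm w c :=
  le_of_tendsto hc.hasSum.norm (Eventually.of_forall (norm_sum_le_unconditionalNorm hc))

/-- The renorming is equivalent to the original norm. -/
lemma exists_unconditionalNorm_le : ∃ C : ℝ, ∀ c : ℕ → ℝ, Summable (fun i => c i • w i) →
    unconditionalNorm w c ≤ C * ‖∑' i, c i • w i‖ := by
  obtain ⟨C, hC⟩ := exists_theta_bound w
  exact ⟨C, fun c hc => ciSup_le (hC c hc)⟩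

/-- If the basis is 1-unconditional, the renorming is the original norm. -/
lemma unconditionalNorm_eq (h1 : ∀ (A : Finset ℕ) (θ : ℕ → Icc (-1 : ℝ) 1) (c : ℕ → ℝ),
      ‖∑ i ∈ A, ((θ i : ℝ) * c i) • w i‖ ≤ ‖∑ i ∈ A, c i • w i‖)
    {c : ℕ → ℝ} (hc : Summable (fun i => c i • w i)) :
    unconditionalNorm w c = ‖∑' i, c i • w i‖ := by
  classical
  refine le_antisymm (ciSup_le fun p => (h1 _ _ _).trans ?_) (norm_tsum_le_unconditionalNorm hc)
  refine ge_of_tendsto hc.hasSum.norm ?_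
  filter_upwards [eventually_ge_atTop p.1] with B hB
  have h := h1 B (fun i => if i ∈ p.1 then ⟨1, by norm_num⟩ else ⟨0, by norm_num⟩) c
  refine le_trans (le_of_eq ?_) h
  congr 1
  rw [← Finset.sum_subset hB]
  · exact Finset.sum_congr rfl fun i hi => by simp [hi]
  · intro i _ hi
    simp [hi]

lemma unconditionalNorm_mono {c d : ℕ → ℝ} (hd : Summable (fun i => d i • w i))
    (hcd : ∀ i, |c i| ≤ |d i|) : unconditionalNorm w c ≤ unconditionalNorm w d := by
  refine ciSup_le fun p => ?_
  have hθ : ∀ i, ∃ t : Icc (-1 : ℝ) 1, (t : ℝ) * d i = (p.2 i : ℝ) * c i := by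
    intro i
    have hp : |(p.2 i : ℝ)| ≤ 1 := abs_le.2 (p.2 i).2
    by_cases h0 : d i = 0
    · have : c i = 0 := by
        have := hcd i
        simpa [h0] using this
      exact ⟨⟨0, by norm_num⟩, by simp [this]⟩
    · have hdp : 0 < |d i| := abs_pos.2 h0
      refine ⟨⟨(p.2 i : ℝ) * c i / d i, abs_le.1 ?_⟩, div_mul_cancel₀ _ h0⟩
      rw [abs_div, abs_mul, div_le_one hdp]
      nlinarith [hcd i, abs_nonneg (c i)]
  choose θ hθ using hθ
  have := le_unconditionalNorm hd p.1 θ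
  simpa only [hθ] using this

lemma unconditionalNorm_add_le {c d : ℕ → ℝ} (hc : Summable (fun i => c i • w i))
    (hd : Summable (fun i => d i • w i)) :
    unconditionalNorm w (fun i => c i + d i) ≤ unconditionalNorm w c + unconditionalNorm w d := by
  refine ciSup_le fun p => ?_
  have : ∑ i ∈ p.1, ((p.2 i : ℝ) * (c i + d i)) • w i =
      ∑ i ∈ p.1, ((p.2 i : ℝ) * c i) • w i + ∑ i ∈ p.1, ((p.2 i : ℝ) * d i) • w i := by
    rw [← Finset.sum_add_distrib]
    simp only [mul_add, add_smul]
  rw [this]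
  exact (norm_add_le _ _).trans
    (add_le_add (le_unconditionalNorm hc _ _) (le_unconditionalNorm hd _ _))

lemma unconditionalNorm_smul (r : ℝ) (c : ℕ → ℝ) :
    unconditionalNorm w (fun i => r * c i) = |r| * unconditionalNorm w c := by
  unfold unconditionalNorm
  rw [Real.mul_iSup_of_nonneg (abs_nonneg r)]
  congr 1
  ext p
  rw [← Real.norm_eq_abs, ← norm_smul, Finset.smul_sum]
  congr 1
  refine Finset.sum_congr rfl fun i _ => ?_
  rw [smul_smul]
  congr 1
  ring

/-- Domination: in a Banach space with an unconditional basis, the coefficient sequences of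
convergent series form a solid set. -/
lemma summable_of_abs_le {c d : ℕ → ℝ} (hd : Summable (fun i => d i • w i))
    (hcd : ∀ i, |c i| ≤ |d i|) : Summable (fun i => c i • w i) := by
  classical
  rw [summable_iff_vanishing_norm] at hd ⊢
  intro ε hε
  obtain ⟨s, hs⟩ := hd (ε / 4) (by positivity)
  refine ⟨s, fun t ht => ?_⟩
  have hθ : ∀ i, ∃ t : Icc (-1 : ℝ) 1, (t : ℝ) * d i = c i := by
    intro i
    by_cases h0 : d i = 0
    · have : c i = 0 := by
        have := hcd i
        simpa [h0] using this
      exact ⟨⟨0, by norm_num⟩, by simp [this]⟩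
    · have hdp : 0 < |d i| := abs_pos.2 h0
      refine ⟨⟨c i / d i, abs_le.1 ?_⟩, div_mul_cancel₀ _ h0⟩
      rw [abs_div, div_le_one hdp]
      exact hcd i
  choose θ hθ using hθ
  have := norm_theta_sum_le (x := fun i => if i ∈ s then 0 else d i • w i) (M := ε / 4)
    (fun A => by
      have h := hs (A \ s) Finset.sdiff_disjoint
      refine le_trans (le_of_eq ?_) h.le
      congr 1
      rw [Finset.sum_ite, Finset.sum_const_zero, zero_add, Finset.sdiff_eq_filter]) t θ
  refine lt_of_le_of_lt (le_trans (le_of_eq ?_) this) (by linarith)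
  congr 1
  refine Finset.sum_congr rfl fun i hi => ?_
  have his : i ∉ s := Finset.disjoint_left.1 ht hi
  simp [his, smul_smul, hθ]

end Unconditional

/-- The data from which a Peetre space is built: symmetric spaces `F ⋐ E`, a seminormalized
unconditional basis `w` of `W`, and positive sequences `a` (non-decreasing, tending to infinity)
and `b` (non-increasing, summable). -/
structure PeetreData (W : Type*) [NormedAddCommGroup W] [NormedSpace ℝ W] where
  E : SymmetricSpace
  F : SymmetricSpace
  absCont : F.AbsContIncluded E
  w : UnconditionalSchauderBasis ℕ ℝ W
  seminormalized : ∃ c C : ℝ, 0 < c ∧ ∀ i, c ≤ ‖w i‖ ∧ ‖w i‖ ≤ C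
  a : ℕ → ℝ
  b : ℕ → ℝ
  a_pos : ∀ i, 0 < a i
  b_pos : ∀ i, 0 < b i
  a_mono : Monotone a
  b_anti : Antitone b
  a_tendsto : Tendsto a atTop atTop
  b_summable : Summable b

namespace PeetreData

variable {W : Type*} [NormedAddCommGroup W] [NormedSpace ℝ W] (D : PeetreData W)

/-- The sequence `i ↦ k(f; aᵢ, bᵢ)`; meaningful if all its entries are finite. -/
def kSeq (f : MeasFun) (i : ℕ) : ℝ := (D.E.kFun D.F (D.a i) (D.b i) f).toReal

/-- `f` belongs to `K(E,F;W)`: every `k(f;aᵢ,bᵢ)` is finite, and `∑ k(f;aᵢ,bᵢ) wᵢ` converges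
in `W`. -/
def MemK (f : MeasFun) : Prop :=
  (∀ i, D.E.kFun D.F (D.a i) (D.b i) f < ∞) ∧ Summable (fun i => D.kSeq f i • D.w i)

variable {D}

lemma kSeq_nonneg (f : MeasFun) (i : ℕ) : 0 ≤ D.kSeq f i := ENNReal.toReal_nonneg

lemma kSeq_smul (c : ℝ) (f : MeasFun) (i : ℕ) : D.kSeq (c • f) i = |c| * D.kSeq f i := by
  simp [kSeq, SymmetricSpace.kFun_smul]

lemma kSeq_add_le {f g : MeasFun} (hf : D.MemK f) (hg : D.MemK g) (i : ℕ) :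
    D.kSeq (f + g) i ≤ D.kSeq f i + D.kSeq g i := by
  unfold kSeq
  rw [← ENNReal.toReal_add (hf.1 i).ne (hg.1 i).ne]
  exact ENNReal.toReal_mono (ENNReal.add_ne_top.2 ⟨(hf.1 i).ne, (hg.1 i).ne⟩)
    (SymmetricSpace.kFun_add_le _ _ _ _ _ _)

lemma MemK.smul {f : MeasFun} (hf : D.MemK f) (c : ℝ) : D.MemK (c • f) := by
  refine ⟨fun i => ?_, ?_⟩
  · rw [SymmetricSpace.kFun_smul]
    exact ENNReal.mul_lt_top ENNReal.ofReal_lt_top (hf.1 i)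
  · simp only [kSeq_smul, mul_smul]
    exact hf.2.const_smul _

lemma memK_zero : D.MemK 0 := by
  have h : ∀ i, D.E.kFun D.F (D.a i) (D.b i) 0 = 0 := fun i => by
    simpa using D.E.kFun_smul D.F (D.a i) (D.b i) 0 0
  refine ⟨fun i => by simp [h], ?_⟩
  simp [kSeq, h, summable_zero]

lemma memK_one [CompleteSpace W] : D.MemK 1 := by
  have h : ∀ i, D.E.kFun D.F (D.a i) (D.b i) 1 ≤ ENNReal.ofReal (D.b i) := fun i => by
    simpa [SymmetricSpace.enorm_zero, D.F.enorm_one] using D.E.kFun_le D.F (D.a i) (D.b i) 0 1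
  refine ⟨fun i => (h i).trans_lt ENNReal.ofReal_lt_top, ?_⟩
  obtain ⟨c, C, -, hC⟩ := D.seminormalized
  refine Summable.of_norm_bounded (D.b_summable.mul_right C) fun i => ?_
  rw [norm_smul, Real.norm_of_nonneg (kSeq_nonneg _ _)]
  refine mul_le_mul ?_ (hC i).2 (norm_nonneg _) (D.b_pos i).le
  exact ENNReal.toReal_le_of_le_ofReal (D.b_pos i).le (h i)

variable [CompleteSpace W]

lemma MemK.add {f g : MeasFun} (hf : D.MemK f) (hg : D.MemK g) : D.MemK (f + g) := by
  refine ⟨fun i => (SymmetricSpace.kFun_add_le _ _ _ _ _ _).trans_lt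
    (ENNReal.add_lt_top.2 ⟨hf.1 i, hg.1 i⟩), ?_⟩
  have h : Summable fun i => (D.kSeq f i + D.kSeq g i) • D.w i := by
    simp only [add_smul]
    exact hf.2.add hg.2
  refine summable_of_abs_le h fun i => ?_
  rw [abs_of_nonneg (kSeq_nonneg _ _),
    abs_of_nonneg (add_nonneg (kSeq_nonneg _ _) (kSeq_nonneg _ _))]
  exact kSeq_add_le hf hg i

variable (D)

/-- The Peetre space `K(E,F;W)` as a linear space of measurable functions. -/
def submodule : Submodule ℝ MeasFun where
  carrier := {f | D.MemK f}
  zero_mem' := memK_zero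
  add_mem' := fun hf hg => hf.add hg
  smul_mem' := fun c _ hf => hf.smul c

/-- The Peetre space `K(E,F;W)`. -/
def Space : Type := D.submodule

instance : AddCommGroup D.Space := inferInstanceAs (AddCommGroup D.submodule)
instance : Module ℝ D.Space := inferInstanceAs (Module ℝ D.submodule)

/-- The norm of `∑ k(f;aᵢ,bᵢ) wᵢ` in `W`, before it is scaled so that `χ_[0,1]` gets norm one. -/
def gauge (f : MeasFun) : ℝ := unconditionalNorm D.w (D.kSeq f)

/-- The norm of `K(E,F;W)`. -/
instance : Norm D.Space := ⟨fun f => D.gauge f.1 / D.gauge 1⟩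

lemma norm_def (f : D.Space) : ‖f‖ = D.gauge f.1 / D.gauge 1 := rfl

variable {D}

lemma gauge_eq_zero {f : MeasFun} (hf : D.MemK f) (h : D.gauge f = 0) : f = 0 := by
  have h0 := norm_sum_le_unconditionalNorm hf.2 {0}
  rw [Finset.sum_singleton, norm_smul] at h0
  obtain ⟨c, C, hc, hC⟩ := D.seminormalized
  have hw : ‖D.w 0‖ ≠ 0 := (hc.trans_le (hC 0).1).ne'
  have h1 : ‖D.kSeq f 0‖ * ‖D.w 0‖ = 0 := le_antisymm (h0.trans_eq h) (by positivity)
  have h2 : D.kSeq f 0 = 0 := by simpa [hw] using h1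
  refine SymmetricSpace.kFun_eq_zero D.absCont.1 (D.a_pos 0) (D.b_pos 0) ?_
  rcases (ENNReal.toReal_eq_zero_iff _).1 h2 with h3 | h3
  · exact h3
  · exact absurd h3 (hf.1 0).ne

lemma gauge_one_pos : 0 < D.gauge 1 :=
  lt_of_le_of_ne (unconditionalNorm_nonneg _) fun h =>
    D.E.one_ne_zero (gauge_eq_zero memK_one h.symm)

lemma gauge_add_le {f g : MeasFun} (hf : D.MemK f) (hg : D.MemK g) :
    D.gauge (f + g) ≤ D.gauge f + D.gauge g := by
  have h : Summable fun i => (D.kSeq f i + D.kSeq g i) • D.w i := by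
    simp only [add_smul]
    exact hf.2.add hg.2
  refine (unconditionalNorm_mono h fun i => ?_).trans (unconditionalNorm_add_le hf.2 hg.2)
  rw [abs_of_nonneg (kSeq_nonneg _ _),
    abs_of_nonneg (add_nonneg (kSeq_nonneg _ _) (kSeq_nonneg _ _))]
  exact kSeq_add_le hf hg i

lemma gauge_smul (c : ℝ) (f : MeasFun) : D.gauge (c • f) = |c| * D.gauge f := by
  have h : D.kSeq (c • f) = fun i => |c| * D.kSeq f i := funext (kSeq_smul c f)
  rw [gauge, gauge, h, unconditionalNorm_smul, abs_abs]

variable (D)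

lemma normCore : NormedSpace.Core ℝ D.Space where
  norm_nonneg f := div_nonneg (unconditionalNorm_nonneg _) (unconditionalNorm_nonneg _)
  norm_smul c f := by
    rw [norm_def, norm_def, Real.norm_eq_abs, ← mul_div_assoc, ← gauge_smul]
    rfl
  norm_triangle f g := by
    rw [norm_def, norm_def, norm_def, ← add_div]
    exact div_le_div_of_nonneg_right (gauge_add_le f.2 g.2) gauge_one_pos.le
  norm_eq_zero_iff f := by
    rw [norm_def, div_eq_zero_iff]
    constructor
    · rintro (h | h)
      · exact Subtype.ext (gauge_eq_zero f.2 h)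
      · exact absurd h gauge_one_pos.ne'
    · rintro rfl
      left
      have := gauge_smul (D := D) 0 0
      exact (by simpa using this : D.gauge (0 : MeasFun) = 0)

instance : NormedAddCommGroup D.Space := NormedAddCommGroup.ofCore D.normCore
instance : NormedSpace ℝ D.Space := NormedSpace.ofCore D.normCore

/-- If `w` is 1-unconditional, then `‖f‖_K = ‖∑ k(f;aᵢ,bᵢ) wᵢ‖ / ‖∑ k(χ_[0,1];aᵢ,bᵢ) wᵢ‖`. -/
lemma norm_eq (h1 : ∀ (A : Finset ℕ) (θ : ℕ → Icc (-1 : ℝ) 1) (c : ℕ → ℝ),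
      ‖∑ i ∈ A, ((θ i : ℝ) * c i) • D.w i‖ ≤ ‖∑ i ∈ A, c i • D.w i‖) (f : D.Space) :
    ‖f‖ = ‖∑' i, D.kSeq f.1 i • D.w i‖ / ‖∑' i, D.kSeq 1 i • D.w i‖ := by
  rw [norm_def, gauge, gauge, unconditionalNorm_eq h1 f.2.2, unconditionalNorm_eq h1 memK_one.2]

/-- In general, the norm of `K(E,F;W)` is equivalent to `f ↦ ‖∑ k(f;aᵢ,bᵢ) wᵢ‖`. -/
lemma norm_equiv : ∃ m M : ℝ, 0 < m ∧ 0 < M ∧ ∀ f : D.Space,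
    m * ‖∑' i, D.kSeq f.1 i • D.w i‖ ≤ ‖f‖ ∧ ‖f‖ ≤ M * ‖∑' i, D.kSeq f.1 i • D.w i‖ := by
  obtain ⟨C, hC⟩ := exists_unconditionalNorm_le (w := D.w)
  have hp := gauge_one_pos (D := D)
  refine ⟨1 / D.gauge 1, (|C| + 1) / D.gauge 1, by positivity, by positivity, fun f => ⟨?_, ?_⟩⟩
  · rw [norm_def, one_div, inv_mul_eq_div]
    exact div_le_div_of_nonneg_right (norm_tsum_le_unconditionalNorm f.2.2) hp.le
  · rw [norm_def, div_mul_eq_mul_div]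
    refine div_le_div_of_nonneg_right ((hC _ f.2.2).trans ?_) hp.le
    refine mul_le_mul_of_nonneg_right ?_ (norm_nonneg _)
    linarith [le_abs_self C]

end PeetreData

/-- A real normed space is reflexive if the canonical map into its bidual is onto. -/
def IsReflexive (X : Type*) [NormedAddCommGroup X] [NormedSpace ℝ X] : Prop :=
  Function.Surjective (NormedSpace.inclusionInDoubleDual ℝ X)

/-- Weak sequential completeness: every weakly Cauchy sequence converges weakly. -/
def IsWeaklySequentiallyComplete (X : Type*) [NormedAddCommGroup X] [NormedSpace ℝ X] : Prop :=
  ∀ x : ℕ → X, (∀ φ : StrongDual ℝ X, CauchySeq fun n => φ (x n)) →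
    ∃ y : X, ∀ φ : StrongDual ℝ X, Tendsto (fun n => φ (x n)) atTop (𝓝 (φ y))

end

/-! Two facts carry the proof. First, the inclusion `toE` of `K` into `E` maps bounded sets to
relatively weakly compact ones. A bounded `f` splits as `u + v` with `‖u‖_E` at most a constant over
`aᵢ`, hence small for large `i`, and with `v` in a fixed ball of `F`. Absolute continuity of the
inclusion makes the parts of such `v` above a high level `M` uniformly small in `E`. What remains
lies in the order interval `[-M,M]`, which is weakly compact in `E` by comparison with `L²`.
Grothendieck's lemma combines these approximations (`relWeaklyCompact_image_toE`).

Second, up to the factor `D.gauge 1`, `diag` embeds `K` isometrically in the `W`-direct sum of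
copies of `E` normed by `k(·;aᵢ,bᵢ)`. Functionals on `K` therefore extend to the sum. The first `N`
coordinates of `diag f` depend continuously on `f` as an element of `E`, so weak limits in `E`
control them and only tails matter.

If `W` is weakly sequentially complete, its basis is boundedly complete, so a weak limit in `E` of a
bounded family of `K` lies in `K` (`exists_toE_eq_of_weakLim`). If `W` is reflexive, functionals on
the sum have uniformly small tails on balls (`exists_abs_apply_sub_trunc_le`), so the weak limit in
`E` is a weak limit in `K`; balls of `K` are weakly compact. If `W` is only weakly sequentially
complete, Mazur's lemma gives convex combinations of the differences from the limit that are norm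
null in `E`. A gliding hump argument (`weakLim_zero_of_trunc`) shows that they are weakly null in
the sum. This identifies the limit of the original weakly Cauchy sequence. -/

noncomputable section

set_option linter.unusedSectionVars false

/-! ### Weak limits, relative weak compactness and reflexivity. -/

section WeakTopology

variable {X : Type*} [NormedAddCommGroup X] [NormedSpace ℝ X]

/-- `x` is the limit of the family `u` along `l` in the weak topology. -/
def WeakLim {ι X : Type*} [NormedAddCommGroup X] [NormedSpace ℝ X] (l : Filter ι) (u : ι → X)
    (x : X) : Prop :=
  ∀ φ : StrongDual ℝ X, Tendsto (fun i => φ (u i)) l (𝓝 (φ x))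

/-- Relative weak compactness, expressed by ultrafilters. -/
def RelWeaklyCompact {X : Type*} [NormedAddCommGroup X] [NormedSpace ℝ X] (A : Set X) : Prop :=
  ∀ U : Ultrafilter X, A ∈ U → ∃ x, WeakLim (U : Filter X) id x

lemma RelWeaklyCompact.exists_weakLim {ι : Type*} {A : Set X} (hA : RelWeaklyCompact A)
    (U : Ultrafilter ι) {u : ι → X} (hu : ∀ᶠ i in (U : Filter ι), u i ∈ A) :
    ∃ x, WeakLim (U : Filter ι) u x := by
  obtain ⟨x, hx⟩ := hA (U.map u) hu
  exact ⟨x, fun φ => (hx φ).comp (tendsto_map (f := u))⟩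

lemma WeakLim.comp {ι Y : Type*} [NormedAddCommGroup Y] [NormedSpace ℝ Y] {l : Filter ι}
    {u : ι → X} {x : X} (h : WeakLim l u x) (T : X →L[ℝ] Y) :
    WeakLim l (fun i => T (u i)) (T x) :=
  fun φ => h (φ.comp T)

/-- Hahn–Banach separation: a limit outside `C` would be strictly separated from `C` by a
functional. -/
lemma WeakLim.mem_of_convex_closed {ι : Type*} {l : Filter ι} [l.NeBot] {u : ι → X} {x : X}
    (h : WeakLim l u x) {C : Set X} (hc : Convex ℝ C) (hcl : IsClosed C)
    (hu : ∀ᶠ i in l, u i ∈ C) : x ∈ C := by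
  by_contra hx
  obtain ⟨φ, s, h1, h2⟩ := geometric_hahn_banach_closed_point hc hcl hx
  have : φ x ≤ s := le_of_tendsto (h φ) (hu.mono fun i hi => (h1 _ hi).le)
  linarith

lemma WeakLim.norm_le {ι : Type*} {l : Filter ι} [l.NeBot] {u : ι → X} {x : X}
    (h : WeakLim l u x) {R : ℝ} (hu : ∀ᶠ i in l, ‖u i‖ ≤ R) : ‖x‖ ≤ R := by
  have := h.mem_of_convex_closed (convex_closedBall 0 R) Metric.isClosed_closedBall
    (hu.mono fun i hi => by simpa using hi)
  simpa using this

lemma WeakLim.sub {ι : Type*} {l : Filter ι} {u v : ι → X} {x y : X}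
    (h : WeakLim l u x) (h' : WeakLim l v y) : WeakLim l (fun i => u i - v i) (x - y) := by
  intro φ
  simpa using (h φ).sub (h' φ)

/-- Each scalar sequence converges, and its limit can be read off along any finer filter. -/
lemma weakLim_of_cauchy_of_weakLim {u : ℕ → X} {x : X}
    (hu : ∀ φ : StrongDual ℝ X, CauchySeq fun n => φ (u n)) {l : Filter ℕ} [l.NeBot]
    (hl : l ≤ atTop) (h : WeakLim l u x) : WeakLim atTop u x := by
  intro φ
  obtain ⟨c, hc⟩ := cauchySeq_tendsto_of_complete (hu φ)
  rwa [tendsto_nhds_unique (h φ) (hc.mono_left hl)]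

/-- Grothendieck's lemma: a set that is approximated within every `ε` by relatively weakly compact
sets is relatively weakly compact. -/
lemma relWeaklyCompact_of_approx [CompleteSpace X] {A : Set X}
    (h : ∀ ε > 0, ∃ B : Set X, RelWeaklyCompact B ∧ ∀ x ∈ A, ∃ y ∈ B, ‖x - y‖ ≤ ε) :
    RelWeaklyCompact A := by
  classical
  intro U hU
  obtain ⟨ε, -, hε, hε0⟩ := exists_seq_strictAnti_tendsto (0 : ℝ)
  choose B hB hAB using fun n => h (ε n) (hε n)
  choose! π hπ hπn using hAB
  -- The weak limits `y n` of the approximants form a Cauchy sequence, because the norm is weakly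
  -- lower semicontinuous. Their norm limit is the required weak limit.
  choose y hy using fun n => (hB n).exists_weakLim U (u := π n) (mem_of_superset hU (hπ n))
  have hdist : ∀ n m, ‖y n - y m‖ ≤ ε n + ε m := fun n m =>
    ((hy n).sub (hy m)).norm_le <| mem_of_superset hU fun x hx => by
      have h1 := hπn n x hx
      have h2 := hπn m x hx
      calc ‖π n x - π m x‖ = ‖(x - π m x) - (x - π n x)‖ := by congr 1; abel
        _ ≤ ‖x - π m x‖ + ‖x - π n x‖ := norm_sub_le _ _
        _ ≤ ε n + ε m := by linarith
  have hcau : CauchySeq y := by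
    rw [Metric.cauchySeq_iff']
    intro δ hδ
    obtain ⟨N, hN⟩ := ((hε0.eventually (gt_mem_nhds (half_pos hδ))).exists_forall_of_atTop)
    refine ⟨N, fun n hn => ?_⟩
    rw [dist_eq_norm]
    linarith [hdist n N, hN n hn, hN N le_rfl]
  obtain ⟨z, hz⟩ := cauchySeq_tendsto_of_complete hcau
  refine ⟨z, fun φ => ?_⟩
  rw [Metric.tendsto_nhds]
  intro δ hδ
  have h1 : Tendsto (fun n => ‖φ‖ * ε n + |φ (y n) - φ z|) atTop (𝓝 0) := by
    have h2 : Tendsto (fun n => |φ (y n) - φ z|) atTop (𝓝 0) := by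
      have := ((φ.continuous.tendsto z).comp hz).sub_const (φ z)
      simpa using this.abs
    simpa using (hε0.const_mul ‖φ‖).add h2
  obtain ⟨n, hn⟩ := (h1.eventually (gt_mem_nhds (half_pos hδ))).exists
  filter_upwards [hU, Metric.tendsto_nhds.1 (hy n φ) _ (half_pos hδ)] with x hx hx'
  have h3 : |φ x - φ (π n x)| ≤ ‖φ‖ * ε n := by
    rw [← map_sub, ← Real.norm_eq_abs]
    exact (φ.le_opNorm _).trans (by gcongr; exact hπn n x hx)
  rw [Real.dist_eq] at hx' ⊢
  simp only [id]
  calc |φ x - φ z| = |(φ x - φ (π n x)) + (φ (π n x) - φ (y n)) + (φ (y n) - φ z)| := by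
        congr 1; ring
    _ ≤ |φ x - φ (π n x)| + |φ (π n x) - φ (y n)| + |φ (y n) - φ z| := abs_add_three _ _ _
    _ < δ := by linarith

/-- Bounded sets of a reflexive space are relatively weakly compact. -/
lemma IsReflexive.relWeaklyCompact (hX : IsReflexive X) {A : Set X} {R : ℝ}
    (hA : ∀ x ∈ A, ‖x‖ ≤ R) : RelWeaklyCompact A := by
  intro U hU
  have hlim : ∀ φ : StrongDual ℝ X, ∃ c, Tendsto φ U (𝓝 c) := fun φ => by
    have hmem : Icc (-(‖φ‖ * R)) (‖φ‖ * R) ∈ U.map φ := by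
      rw [Ultrafilter.mem_map]
      exact mem_of_superset hU fun x hx => abs_le.1 ((φ.le_opNorm x).trans (by gcongr; exact hA x hx))
    obtain ⟨c, -, hc⟩ := isCompact_Icc.ultrafilter_le_nhds (U.map φ) (le_principal_iff.2 hmem)
    exact ⟨c, hc⟩
  choose L hL using hlim
  -- The limits along `U` define an element of the bidual of norm at most `R`; reflexivity
  -- represents it by a vector.
  let Φ : StrongDual ℝ (StrongDual ℝ X) := LinearMap.mkContinuous
    { toFun := L
      map_add' := fun φ ψ => tendsto_nhds_unique (hL (φ + ψ)) ((hL φ).add (hL ψ))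
      map_smul' := fun c φ => tendsto_nhds_unique (hL (c • φ)) ((hL φ).const_mul c) } R
    (fun φ => by
      refine le_of_tendsto (hL φ).norm (mem_of_superset hU fun x hx => ?_)
      rw [mul_comm]
      exact (φ.le_opNorm x).trans (by gcongr; exact hA x hx))
  obtain ⟨x, hx⟩ := hX Φ
  refine ⟨x, fun φ => ?_⟩
  have : φ x = L φ := by
    rw [← NormedSpace.dual_def ℝ X x φ, hx]
    rfl
  rw [this]
  exact hL φ

/-- Composing `Φ` with the Riesz map gives a functional on `H`, and its Riesz vector represents `Φ`.
-/
lemma isReflexive_of_inner {H : Type*} [NormedAddCommGroup H] [InnerProductSpace ℝ H]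
    [CompleteSpace H] : IsReflexive H := by
  intro Φ
  let T : H →L[ℝ] StrongDual ℝ H := innerSL ℝ
  refine ⟨(InnerProductSpace.toDual ℝ H).symm (Φ.comp T), ?_⟩
  ext φ
  obtain ⟨z, rfl⟩ := (InnerProductSpace.toDual ℝ H).surjective φ
  rw [NormedSpace.dual_def, InnerProductSpace.toDual_apply_apply, real_inner_comm,
    InnerProductSpace.toDual_symm_apply]
  rfl

/-- Helly's theorem. -/
lemma exists_approx_of_doubleDual (Φ : StrongDual ℝ (StrongDual ℝ X))
    (S : Finset (StrongDual ℝ X)) {ε : ℝ} (hε : 0 < ε) :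
    ∃ x : X, ‖x‖ ≤ ‖Φ‖ + 1 ∧ ∀ φ ∈ S, |φ x - Φ φ| < ε := by
  classical
  -- The summand `1` only makes `R` positive. If the vector of values of `Φ` on `S` were not in the
  -- closure of the image of the ball, a separating functional would pull back to one of norm at
  -- most `s / R`, contradicting `‖Φ‖ ≤ R`.
  set R := ‖Φ‖ + 1 with hR
  have hRpos : 0 < R := by positivity
  let T : X →L[ℝ] (S → ℝ) := ContinuousLinearMap.pi fun s => s.1
  let p : S → ℝ := fun s => Φ s.1
  have hp : p ∈ closure (T '' Metric.closedBall 0 R) := by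
    by_contra hp
    obtain ⟨g, s, h1, h2⟩ := geometric_hahn_banach_closed_point
      ((convex_closedBall (0 : X) R).linear_image T.toLinearMap).closure isClosed_closure hp
    have hψ : ∀ x, ‖x‖ ≤ R → g (T x) ≤ s := fun x hx =>
      (h1 _ (subset_closure ⟨x, by simpa using hx, rfl⟩)).le
    have hg : ∀ q : S → ℝ, g q = ∑ i, q i * g (Pi.single i 1) := fun q => by
      conv_lhs => rw [pi_eq_sum_univ q, map_sum]
      refine Finset.sum_congr rfl fun i _ => ?_
      rw [map_smul, smul_eq_mul]
      congr 2
      ext j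
      simp [Pi.single_apply, eq_comm]
    have hΦ : Φ (g.comp T) = g p := by
      have : g.comp T = ∑ i : S, g (Pi.single i 1) • i.1 := by
        ext x
        rw [ContinuousLinearMap.comp_apply, hg]
        simp [T, mul_comm]
      rw [this, map_sum, hg]
      refine Finset.sum_congr rfl fun i _ => ?_
      simp [p, mul_comm]
    have hs : 0 ≤ s := by simpa using hψ 0 (by simpa using hRpos.le)
    have hn : ‖g.comp T‖ ≤ s / R := by
      refine ContinuousLinearMap.opNorm_le_bound _ (by positivity) fun x => ?_
      rcases eq_or_ne x 0 with rfl | hx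
      · simp
      have hx' : 0 < ‖x‖ := norm_pos_iff.2 hx
      have hb : ∀ c : ℝ, |c| = R / ‖x‖ → c * g (T x) ≤ s := fun c hc => by
        have := hψ (c • x) (by
          rw [norm_smul, Real.norm_eq_abs, hc, div_mul_cancel₀ _ hx'.ne'])
        simpa using this
      have h3 := hb (R / ‖x‖) (abs_of_pos (by positivity))
      have h4 := hb (-(R / ‖x‖)) (by rw [abs_neg]; exact abs_of_pos (by positivity))
      rw [ContinuousLinearMap.comp_apply, Real.norm_eq_abs, div_mul_eq_mul_div, le_div_iff₀ hRpos]
      have h5 : R / ‖x‖ * |g (T x)| ≤ s := by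
        rcases abs_cases (g (T x)) with h | h <;> rw [h.1] <;> linarith
      rw [div_mul_eq_mul_div, div_le_iff₀ hx'] at h5
      linarith
    have h6 : g p ≤ s := by
      rw [← hΦ]
      calc Φ (g.comp T) ≤ ‖Φ‖ * ‖g.comp T‖ := (le_abs_self _).trans (Φ.le_opNorm _)
        _ ≤ R * (s / R) := by gcongr; linarith
        _ = s := mul_div_cancel₀ _ hRpos.ne'
    linarith
  obtain ⟨_, ⟨x, hx, rfl⟩, hd⟩ := Metric.mem_closure_iff.1 hp ε hε
  refine ⟨x, by simpa using hx, fun φ hφ => ?_⟩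
  have := (dist_le_pi_dist p (T x) ⟨φ, hφ⟩).trans_lt hd
  rwa [dist_comm, Real.dist_eq] at this

/-- Helly's theorem gives a net in one ball that approximates `Φ`, indexed by finite sets of
functionals and tolerances. A weak limit along an ultrafilter finer than `atTop` represents `Φ`. -/
lemma isReflexive_of_relWeaklyCompact
    (h : ∀ R : ℝ, RelWeaklyCompact (Metric.closedBall (0 : X) R)) : IsReflexive X := by
  classical
  intro Φ
  choose x hx hxΦ using fun p : Finset (StrongDual ℝ X) × ℕ =>
    exists_approx_of_doubleDual Φ p.1 (ε := 1 / ((p.2 : ℝ) + 1)) (by positivity)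
  let U := Ultrafilter.of (atTop : Filter (Finset (StrongDual ℝ X) × ℕ))
  obtain ⟨y, hy⟩ := (h (‖Φ‖ + 1)).exists_weakLim U (u := x)
    (Eventually.of_forall fun p => by simpa using hx p)
  refine ⟨y, ?_⟩
  ext φ
  rw [NormedSpace.dual_def]
  refine tendsto_nhds_unique (hy φ) (Tendsto.mono_left ?_ (Ultrafilter.of_le _))
  have h0 : Tendsto (fun p : Finset (StrongDual ℝ X) × ℕ => 1 / ((p.2 : ℝ) + 1)) atTop (𝓝 0) := by
    rw [← prod_atTop_atTop_eq]
    exact tendsto_one_div_add_atTop_nhds_zero_nat.comp tendsto_snd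
  rw [tendsto_iff_dist_tendsto_zero]
  refine squeeze_zero' (Eventually.of_forall fun _ => dist_nonneg) ?_ h0
  filter_upwards [eventually_ge_atTop ({φ}, 0)] with p hp
  rw [Real.dist_eq]
  exact (hxΦ p φ (hp.1 (by simp))).le

/-- Uniform boundedness, applied to the vectors as functionals on the dual. -/
lemma exists_norm_le_of_weakly_cauchy {u : ℕ → X}
    (hu : ∀ φ : StrongDual ℝ X, CauchySeq fun n => φ (u n)) : ∃ R, ∀ n, ‖u n‖ ≤ R := by
  obtain ⟨R, hR⟩ := banach_steinhaus (g := fun n => NormedSpace.inclusionInDoubleDual ℝ X (u n))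
    (fun φ => by
      obtain ⟨C, hC⟩ := (hu φ).norm_bddAbove
      exact ⟨C, fun n => hC ⟨n, rfl⟩⟩)
  refine ⟨R, fun n => ?_⟩
  have := (NormedSpace.inclusionInDoubleDualLi (E := X) ℝ).norm_map (u n)
  rw [← this]
  exact hR n

lemma IsReflexive.isWeaklySequentiallyComplete (hX : IsReflexive X) :
    IsWeaklySequentiallyComplete X := by
  intro u hu
  obtain ⟨R, hR⟩ := exists_norm_le_of_weakly_cauchy hu
  obtain ⟨y, hy⟩ := (hX.relWeaklyCompact (A := range u) (R := R)
    (by rintro _ ⟨n, rfl⟩; exact hR n)).exists_weakLim (hyperfilter ℕ) (u := u)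
    (Eventually.of_forall fun n => ⟨n, rfl⟩)
  exact ⟨y, weakLim_of_cauchy_of_weakLim hu Nat.hyperfilter_le_atTop hy⟩

/-- Mazur's lemma for tails of a weakly null sequence. -/
lemma WeakLim.exists_convexHull_norm_lt {ι : Type*} {l : Filter ι} [l.NeBot] {u : ι → X}
    (h : WeakLim l u 0) {s : Set ι} (hs : s ∈ l) {ε : ℝ} (hε : 0 < ε) :
    ∃ z ∈ convexHull ℝ (u '' s), ‖z‖ < ε := by
  have h0 := h.mem_of_convex_closed (convex_convexHull ℝ (u '' s)).closure isClosed_closure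
    (mem_of_superset hs fun i hi => subset_closure (subset_convexHull ℝ _ ⟨i, hi, rfl⟩))
  obtain ⟨z, hz, hd⟩ := Metric.mem_closure_iff.1 h0 ε hε
  exact ⟨z, hz, by simpa using hd⟩

end WeakTopology

/-! ### Truncations and indicator functions. -/

namespace MeasFun

lemma coeFn_cut (x : MeasFun) {e : Set I} (he : MeasurableSet e) :
    (x.cut e he : I → ℝ) =ᵐ[volume] e.indicator x :=
  AEEqFun.coeFn_mk _ _

lemma coeFn_const_smul_one (c : ℝ) : ((c • (1 : MeasFun) : MeasFun) : I → ℝ) =ᵐ[volume]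
    fun _ => c := by
  filter_upwards [AEEqFun.coeFn_smul c (1 : MeasFun),
    AEEqFun.coeFn_one (α := I) (β := ℝ) (μ := volume)] with t h1 h2
  simp [h1, h2]

lemma abs_le_smul_one_iff {x : MeasFun} {M : ℝ} :
    |x| ≤ M • (1 : MeasFun) ↔ ∀ᵐ t, |x t| ≤ M := by
  rw [← AEEqFun.coeFn_le]
  constructor <;> intro h <;>
    filter_upwards [h, AEEqFun.coeFn_abs x, coeFn_const_smul_one M] with t h1 h2 h3
  · rwa [h2, h3] at h1
  · rwa [h2, h3]

lemma cut_add_cut_compl (x : MeasFun) {e : Set I} (he : MeasurableSet e) :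
    x.cut e he + x.cut eᶜ he.compl = x := by
  refine AEEqFun.ext ?_
  filter_upwards [AEEqFun.coeFn_add (x.cut e he) (x.cut eᶜ he.compl), coeFn_cut x he,
    coeFn_cut x he.compl] with t h1 h2 h3
  rw [h1, Pi.add_apply, h2, h3, ← Pi.add_apply, Set.indicator_self_add_compl]

/-- The set where `|x|` is larger than `M`. -/
def levelSet (x : MeasFun) (M : ℝ) : Set I := {t | M < |x t|}

lemma measurableSet_levelSet (x : MeasFun) (M : ℝ) : MeasurableSet (x.levelSet M) :=
  measurableSet_lt measurable_const x.measurable.abs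

/-- The part of `x` where `|x| ≤ M`. -/
def lower (x : MeasFun) (M : ℝ) : MeasFun :=
  x.cut (x.levelSet M)ᶜ (x.measurableSet_levelSet M).compl

/-- The part of `x` where `|x| > M`. -/
def upper (x : MeasFun) (M : ℝ) : MeasFun := x.cut (x.levelSet M) (x.measurableSet_levelSet M)

lemma upper_add_lower (x : MeasFun) (M : ℝ) : x.upper M + x.lower M = x :=
  cut_add_cut_compl x _

lemma abs_lower_le (x : MeasFun) {M : ℝ} (hM : 0 ≤ M) : |x.lower M| ≤ M • (1 : MeasFun) := by
  classical
  rw [abs_le_smul_one_iff]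
  filter_upwards [coeFn_cut x (x.measurableSet_levelSet M).compl] with t h
  rw [lower, h, Set.indicator_apply]
  split_ifs with ht
  · exact not_lt.1 ht
  · simpa using hM

lemma abs_smul_cut_levelSet_le (x : MeasFun) {M : ℝ} (hM : 0 ≤ M) :
    |M • (1 : MeasFun).cut (x.levelSet M) (x.measurableSet_levelSet M)| ≤ |x| := by
  classical
  rw [← AEEqFun.coeFn_le]
  filter_upwards [AEEqFun.coeFn_abs (M • (1 : MeasFun).cut _ (x.measurableSet_levelSet M)),
    AEEqFun.coeFn_abs x, AEEqFun.coeFn_smul M ((1 : MeasFun).cut _ (x.measurableSet_levelSet M)),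
    coeFn_cut 1 (x.measurableSet_levelSet M),
    AEEqFun.coeFn_one (α := I) (β := ℝ) (μ := volume)] with t h1 h2 h3 h4 h5
  rw [h1, h2, h3, Pi.smul_apply, h4, Set.indicator_apply]
  split_ifs with ht
  · rw [h5, Pi.one_apply, smul_eq_mul, mul_one, abs_of_nonneg hM]
    exact le_of_lt ht
  · simp

lemma abs_cut_le_smul_cut_one {x : MeasFun} {M : ℝ} (hx : |x| ≤ M • (1 : MeasFun)) {e : Set I}
    (he : MeasurableSet e) : |x.cut e he| ≤ |M • (1 : MeasFun).cut e he| := by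
  classical
  rw [abs_le_smul_one_iff] at hx
  rw [← AEEqFun.coeFn_le]
  filter_upwards [AEEqFun.coeFn_abs (M • (1 : MeasFun).cut _ he),
    AEEqFun.coeFn_abs (x.cut e he), AEEqFun.coeFn_smul M ((1 : MeasFun).cut _ he),
    coeFn_cut 1 he, coeFn_cut x he,
    AEEqFun.coeFn_one (α := I) (β := ℝ) (μ := volume), hx] with t h1 h2 h3 h4 h5 h6 h7
  rw [h1, h2, h3, Pi.smul_apply, h4, h5, Set.indicator_apply, Set.indicator_apply]
  split_ifs with ht
  · rw [h6, Pi.one_apply, smul_eq_mul, mul_one]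
    exact h7.trans (le_abs_self M)
  · simp

lemma abs_cut_one_le {e : Set I} (he : MeasurableSet e) :
    |(1 : MeasFun).cut e he| ≤ (1 : ℝ) • (1 : MeasFun) := by
  classical
  rw [abs_le_smul_one_iff]
  filter_upwards [coeFn_cut 1 he, AEEqFun.coeFn_one (α := I) (β := ℝ) (μ := volume)] with t h1 h2
  rw [h1, Set.indicator_apply]
  split_ifs <;> simp [h2]

lemma abs_cut_one_le_add {s t u : Set I} (hs : MeasurableSet s) (ht : MeasurableSet t)
    (hu : MeasurableSet u) (h : s ⊆ t ∪ u) :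
    |(1 : MeasFun).cut s hs| ≤ |(1 : MeasFun).cut t ht + (1 : MeasFun).cut u hu| := by
  classical
  rw [← AEEqFun.coeFn_le]
  filter_upwards [coeFn_cut 1 hs, coeFn_cut 1 ht, coeFn_cut 1 hu,
    AEEqFun.coeFn_one (α := I) (β := ℝ) (μ := volume), AEEqFun.coeFn_abs ((1 : MeasFun).cut s hs),
    AEEqFun.coeFn_abs ((1 : MeasFun).cut t ht + (1 : MeasFun).cut u hu),
    AEEqFun.coeFn_add ((1 : MeasFun).cut t ht) ((1 : MeasFun).cut u hu)] with r h1 h2 h3 h4 h5 h6 h7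
  rw [h5, h6, h7, Pi.add_apply, h1, h2, h3]
  simp only [Set.indicator_apply, h4, Pi.one_apply]
  have := @h r
  by_cases hs : r ∈ s <;> by_cases ht : r ∈ t <;> by_cases hu : r ∈ u <;> simp_all; norm_num

/-- The distribution function of an indicator is a step function determined by the measure of the
set. This allows an arbitrary set to be replaced by an interval. -/
lemma equimeasurable_cut_one {e e' : Set I} (he : MeasurableSet e) (he' : MeasurableSet e')
    (h : volume e = volume e') :
    Equimeasurable |(1 : MeasFun).cut e he| |(1 : MeasFun).cut e' he'| := by
  have key : ∀ (s : Set I) (hs : MeasurableSet s) (c : ℝ),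
      volume {t : I | c < (|(1 : MeasFun).cut s hs| : MeasFun) t} =
        if c < 0 then 1 else if c < 1 then volume s else 0 := by
    intro s hs c
    have h1 : ({t : I | c < (|(1 : MeasFun).cut s hs| : MeasFun) t} : Set I) =ᵐ[volume]
        ({t : I | c < s.indicator 1 t} : Set I) := by
      filter_upwards [coeFn_cut 1 hs, AEEqFun.coeFn_abs ((1 : MeasFun).cut s hs),
        AEEqFun.coeFn_one (α := I) (β := ℝ) (μ := volume)] with t h1 h2 h3
      refine propext ?_
      change c < _ ↔ c < _
      rw [h2, h1]
      by_cases ht : t ∈ s <;> simp [ht, h3]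
    rw [measure_congr h1]
    split_ifs with h2 h3
    · have : {t : I | c < s.indicator (1 : I → ℝ) t} = univ := by
        ext t
        by_cases ht : t ∈ s <;> simp [ht, h2]
        linarith
      rw [this, measure_univ]
    · congr 1
      ext t
      by_cases ht : t ∈ s <;> simp [ht, h3]
      exact not_lt.1 h2
    · have : {t : I | c < s.indicator (1 : I → ℝ) t} = ∅ := by
        ext t
        by_cases ht : t ∈ s <;> simp [ht]
        · exact not_lt.1 h3
        · exact not_lt.1 h2
      rw [this, measure_empty]
  intro c
  rw [key, key, h]

end MeasFun

/-! ### Fundamental function and absolute continuity. -/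

namespace SymmetricSpace

variable (E F : SymmetricSpace)

lemma enorm_le_of_abs_le {x : MeasFun} {M : ℝ} (hM : 0 ≤ M) (hx : |x| ≤ M • (1 : MeasFun)) :
    E.enorm x ≤ ENNReal.ofReal M := by
  have h1 : E.enorm (M • (1 : MeasFun)) = ENNReal.ofReal M := by
    rw [E.enorm_smul, E.enorm_one, mul_one, abs_of_nonneg hM]
  rw [← h1]
  exact E.solid _ _ (h1 ▸ ENNReal.ofReal_lt_top) (hx.trans (le_abs_self _))

lemma enorm_cut_one_lt_top {e : Set I} (he : MeasurableSet e) :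
    E.enorm ((1 : MeasFun).cut e he) < ∞ :=
  (E.enorm_le_of_abs_le zero_le_one (MeasFun.abs_cut_one_le he)).trans_lt ENNReal.ofReal_lt_top

lemma enorm_cut_one_le_add {s t u : Set I} (hs : MeasurableSet s) (ht : MeasurableSet t)
    (hu : MeasurableSet u) (h : s ⊆ t ∪ u) : E.enorm ((1 : MeasFun).cut s hs) ≤
      E.enorm ((1 : MeasFun).cut t ht) + E.enorm ((1 : MeasFun).cut u hu) :=
  (E.solid _ _ ((E.enorm_add_le _ _).trans_lt (ENNReal.add_lt_top.2
    ⟨E.enorm_cut_one_lt_top ht, E.enorm_cut_one_lt_top hu⟩))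
    (MeasFun.abs_cut_one_le_add hs ht hu h)).trans (E.enorm_add_le _ _)

lemma enorm_cut_one_le_of_cover {J : ℕ → Set I} (hJ : ∀ k, MeasurableSet (J k)) {c : ℝ≥0∞}
    (hc : ∀ k, E.enorm ((1 : MeasFun).cut (J k) (hJ k)) ≤ c) (m : ℕ) :
    ∀ (s : Set I) (hs : MeasurableSet s), (∀ t ∈ s, ∃ k < m, t ∈ J k) →
      E.enorm ((1 : MeasFun).cut s hs) ≤ m * c := by
  induction m with
  | zero =>
    intro s hs h
    have hs0 : s = ∅ := by
      ext t
      simpa using h t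
    subst hs0
    have : (1 : MeasFun).cut ∅ hs = 0 := by
      refine AEEqFun.ext ?_
      filter_upwards [MeasFun.coeFn_cut 1 hs,
        AEEqFun.coeFn_zero (α := I) (β := ℝ) (μ := volume)] with t h1 h2
      rw [h1, h2]
      simp
    simp [this, E.enorm_zero]
  | succ m ih =>
    intro s hs h
    refine (E.enorm_cut_one_le_add hs (hs.diff (hJ m)) (hJ m) fun t ht => ?_).trans ?_
    · by_cases h' : t ∈ J m
      · exact Or.inr h'
      · exact Or.inl ⟨ht, h'⟩
    · push_cast
      rw [add_mul, one_mul]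
      refine add_le_add (ih _ _ fun t ht => ?_) (hc m)
      obtain ⟨k, hk, htk⟩ := h t ht.1
      refine ⟨k, lt_of_le_of_ne (Nat.lt_succ_iff.1 hk) ?_, htk⟩
      rintro rfl
      exact ht.2 htk

/-- The fundamental function of a symmetric space does not vanish: `[0,1]` is covered by `n + 1`
intervals of measure `mes e` as soon as `mes e ≥ 1/n`. -/
lemma one_le_mul_enorm_cut_one {e : Set I} (he : MeasurableSet e) {n : ℕ} (hn : 0 < n)
    (h : ENNReal.ofReal (1 / n) ≤ volume e) :
    1 ≤ ((n + 1 : ℕ) : ℝ≥0∞) * E.enorm ((1 : MeasFun).cut e he) := by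
  set r : ℝ := (volume e).toReal with hr
  have hr1 : r ≤ 1 := ENNReal.toReal_le_of_le_ofReal zero_le_one (by simpa using prob_le_one)
  have hrn : 1 / (n : ℝ) ≤ r := (ENNReal.ofReal_le_iff_le_toReal (measure_ne_top _ _)).1 h
  have hn' : (0 : ℝ) < n := by exact_mod_cast hn
  have hr0 : 0 ≤ r := ENNReal.toReal_nonneg
  -- Left endpoints advance in steps `1/n ≤ r` and are capped at `1 - r`, so that every interval of
  -- length `r` stays in `[0,1]`. A point `t` lies in the interval with index `⌊t n⌋ ≤ n`.
  let a : ℕ → ℝ := fun k => min (k / n) (1 - r)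
  have ha0 : ∀ k, 0 ≤ a k := fun k => le_min (by positivity) (by linarith)
  have ha1 : ∀ k, a k + r ≤ 1 := fun k => by
    have : a k ≤ 1 - r := min_le_right _ _
    linarith
  let J : ℕ → Set I := fun k =>
    Icc ⟨a k, ha0 k, by linarith [ha1 k]⟩ ⟨a k + r, by linarith [ha0 k], ha1 k⟩
  have hJ : ∀ k, MeasurableSet (J k) := fun k => measurableSet_Icc
  have hvol : ∀ k, volume (J k) = volume e := fun k => by
    rw [unitInterval.volume_Icc]
    simp only [add_sub_cancel_left]
    exact ENNReal.ofReal_toReal (measure_ne_top _ _)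
  have key := E.enorm_cut_one_le_of_cover hJ (c := E.enorm ((1 : MeasFun).cut e he))
    (fun k => (E.symmetric _ _ (E.enorm_cut_one_lt_top he)
      (MeasFun.equimeasurable_cut_one (hJ k) he (hvol k))).le) (n + 1) univ MeasurableSet.univ
    (fun t _ => by
      have ht0 : 0 ≤ (t : ℝ) * n := mul_nonneg t.2.1 hn'.le
      have h1 := Nat.floor_le ht0
      have h2 := Nat.lt_floor_add_one ((t : ℝ) * n)
      refine ⟨⌊(t : ℝ) * n⌋₊, ?_, ?_, ?_⟩
      · rw [Nat.lt_succ_iff]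
        refine Nat.floor_le_of_le ?_
        nlinarith [t.2.2]
      · change min _ _ ≤ (t : ℝ)
        refine (min_le_left _ _).trans ?_
        rwa [div_le_iff₀ hn']
      · change (t : ℝ) ≤ min _ _ + r
        rw [← min_add_add_right]
        refine le_min ?_ (by linarith [t.2.2])
        have h3 : (t : ℝ) ≤ ((⌊(t : ℝ) * n⌋₊ : ℝ) + 1) / n := by
          rw [le_div_iff₀ hn']
          exact h2.le
        rw [add_div] at h3
        linarith)
  have h1 : (1 : MeasFun).cut univ MeasurableSet.univ = 1 := by
    refine AEEqFun.ext ?_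
    filter_upwards [MeasFun.coeFn_cut 1 MeasurableSet.univ] with t h1
    rw [h1, Set.indicator_univ]
  rwa [h1, E.enorm_one] at key

variable {E F}

lemma enorm_cut_le_of_volume_lt (h : F.AbsContIncluded E) {ε : ℝ≥0∞} (hε : 0 < ε) :
    ∃ δ : ℝ, 0 < δ ∧ ∀ (e : Set I) (he : MeasurableSet e), volume e < ENNReal.ofReal δ →
      ∀ x : MeasFun, F.enorm x < ∞ → E.enorm (x.cut e he) ≤ ε * F.enorm x := by
  classical
  have h1 := (h.2.eventually (ge_mem_nhds hε))
  obtain ⟨δ, hδ, hδε⟩ := mem_nhdsGT_iff_exists_Ioo_subset.1 h1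
  refine ⟨δ, hδ, fun e he hlt x hx => ?_⟩
  -- `eta` controls only nonzero `x` and, near `0`, positive measures; in the excluded cases the cut
  -- function is `0`.
  by_cases hx0 : F.enorm x = 0 ∨ volume e = 0
  · have : x.cut e he = 0 := by
      refine AEEqFun.ext ?_
      rcases hx0 with h0 | h0
      · have := F.enorm_eq_zero _ h0
        subst this
        filter_upwards [MeasFun.coeFn_cut 0 he,
          AEEqFun.coeFn_zero (α := I) (β := ℝ) (μ := volume)] with t h1 h2
        rw [h1, h2, Set.indicator_apply, h2]
        simp
      · filter_upwards [MeasFun.coeFn_cut x he,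
          AEEqFun.coeFn_zero (α := I) (β := ℝ) (μ := volume),
          measure_eq_zero_iff_ae_notMem.1 h0] with t h1 h2 h3
        rw [h1, h2, Set.indicator_of_notMem h3]
        rfl
    rw [this, E.enorm_zero]
    exact zero_le
  · push Not at hx0
    have hfin := measure_ne_top volume e
    have hmem : (volume e).toReal ∈ Ioo 0 δ :=
      ⟨ENNReal.toReal_pos hx0.2 hfin, (ENNReal.lt_ofReal_iff_toReal_lt hfin).1 hlt⟩
    have h2 : E.enorm (x.cut e he) / F.enorm x ≤ F.eta E (volume e).toReal :=
      le_iSup_of_le x <| le_iSup_of_le ⟨hx0.1, hx⟩ <| le_iSup_of_le e <| le_iSup_of_le he <|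
        le_iSup_of_le (ENNReal.ofReal_toReal hfin).symm le_rfl
    exact (ENNReal.div_le_iff hx0.1 hx.ne).1 (h2.trans (hδε hmem))

/-- Functions from a ball of `F` are small on their upper level sets, uniformly in `E`. -/
lemma exists_enorm_upper_le (h : F.AbsContIncluded E) {R ε : ℝ} (hR : 0 < R) (hε : 0 < ε) :
    ∃ M : ℝ, 0 ≤ M ∧ ∀ x : MeasFun, F.enorm x ≤ ENNReal.ofReal R →
      E.enorm (x.upper M) ≤ ENNReal.ofReal ε := by
  obtain ⟨δ, hδ, hδE⟩ := enorm_cut_le_of_volume_lt h (ε := ENNReal.ofReal (ε / R))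
    (by simpa using div_pos hε hR)
  obtain ⟨n, hn⟩ := exists_nat_one_div_lt hδ
  -- If the level set had measure at least `1/(n+1)`, its indicator would have `F`-norm at least
  -- `1/(n+2)`. Then `M ≤ (n+2)‖x‖_F ≤ (n+2)R`, which the extra `1` rules out.
  refine ⟨((n + 1 + 1 : ℕ) : ℝ) * R + 1, by positivity, fun x hx => ?_⟩
  set M := ((n + 1 + 1 : ℕ) : ℝ) * R + 1 with hM
  have hM0 : 0 ≤ M := by positivity
  have hxt : F.enorm x < ∞ := hx.trans_lt ENNReal.ofReal_lt_top
  have hvol : volume (x.levelSet M) < ENNReal.ofReal δ := by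
    by_contra hcon
    rw [not_lt] at hcon
    have h1 := F.one_le_mul_enorm_cut_one (x.measurableSet_levelSet M) (Nat.succ_pos n)
      (le_trans (ENNReal.ofReal_le_ofReal (by push_cast; exact hn.le)) hcon)
    have h2 := F.solid _ _ hxt (x.abs_smul_cut_levelSet_le hM0)
    rw [F.enorm_smul, abs_of_nonneg hM0] at h2
    have h3 : ENNReal.ofReal M ≤ ENNReal.ofReal (((n + 1 + 1 : ℕ) : ℝ) * R) := by
      calc ENNReal.ofReal M ≤ ENNReal.ofReal M * (((n + 1 + 1 : ℕ) : ℝ≥0∞) *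
            F.enorm ((1 : MeasFun).cut _ (x.measurableSet_levelSet M))) :=
            le_mul_of_one_le_right' h1
        _ = ((n + 1 + 1 : ℕ) : ℝ≥0∞) * (ENNReal.ofReal M *
            F.enorm ((1 : MeasFun).cut _ (x.measurableSet_levelSet M))) := by ring
        _ ≤ ((n + 1 + 1 : ℕ) : ℝ≥0∞) * ENNReal.ofReal R := by gcongr; exact h2.trans hx
        _ = _ := by rw [ENNReal.ofReal_mul (by positivity), ENNReal.ofReal_natCast]
    rw [ENNReal.ofReal_le_ofReal_iff (by positivity)] at h3
    linarith
  refine (hδE _ (x.measurableSet_levelSet M) hvol x hxt).trans ?_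
  calc _ ≤ ENNReal.ofReal (ε / R) * ENNReal.ofReal R := by gcongr
    _ = ENNReal.ofReal ε := by
      rw [← ENNReal.ofReal_mul (by positivity), div_mul_cancel₀ _ hR.ne']

/-- On order intervals, convergence in measure implies convergence in `E`. -/
lemma tendsto_enorm_of_tendstoInMeasure (h : F.AbsContIncluded E) {y : ℕ → MeasFun} {M : ℝ}
    (hM : 0 ≤ M) (hy : ∀ n, |y n| ≤ M • (1 : MeasFun))
    (hlim : ∀ ε > 0, Tendsto (fun n => volume ((y n).levelSet ε)) atTop (𝓝 0)) :
    Tendsto (fun n => E.enorm (y n)) atTop (𝓝 0) := by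
  rw [ENNReal.tendsto_nhds_zero]
  intro ε hε
  obtain ⟨r, hr0, hrε⟩ : ∃ r : ℝ, 0 < r ∧ ENNReal.ofReal r ≤ ε := by
    rcases eq_or_ne ε ∞ with rfl | hne
    · exact ⟨1, one_pos, le_top⟩
    · exact ⟨ε.toReal, ENNReal.toReal_pos hε.ne' hne, ENNReal.ofReal_toReal_le⟩
  -- After multiplication by `M` this constant is at most `r / 2`; `M + 1` avoids division by zero.
  -- The other half of `r` bounds the part of `y n` below level `r / 2`.
  have hc : 0 < r / 2 / (M + 1) := by positivity
  obtain ⟨δ, hδ, hδE⟩ := enorm_cut_le_of_volume_lt h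
    (ε := ENNReal.ofReal (r / 2 / (M + 1))) (by simpa using hc)
  filter_upwards [(hlim (r / 2) (by positivity)).eventually
    (gt_mem_nhds (ENNReal.ofReal_pos.2 hδ))] with n hn
  refine le_trans ?_ hrε
  have h1 : E.enorm ((y n).upper (r / 2)) ≤ ENNReal.ofReal (r / 2) := by
    have h2 := hδE _ ((y n).measurableSet_levelSet (r / 2)) hn 1 (by rw [F.enorm_one]; simp)
    rw [F.enorm_one, mul_one] at h2
    refine (E.solid _ _ ?_ (MeasFun.abs_cut_le_smul_cut_one (hy n) _)).trans ?_
    · rw [E.enorm_smul]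
      exact ENNReal.mul_lt_top ENNReal.ofReal_lt_top (E.enorm_cut_one_lt_top _)
    · rw [E.enorm_smul, abs_of_nonneg hM]
      calc _ ≤ ENNReal.ofReal M * ENNReal.ofReal (r / 2 / (M + 1)) := by gcongr
        _ ≤ _ := by
          rw [← ENNReal.ofReal_mul hM]
          refine ENNReal.ofReal_le_ofReal ?_
          rw [mul_div_assoc', div_le_iff₀ (by positivity)]
          nlinarith
  rw [← (y n).upper_add_lower (r / 2)]
  calc _ ≤ ENNReal.ofReal (r / 2) + ENNReal.ofReal (r / 2) :=
        (E.enorm_add_le _ _).trans (add_le_add h1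
          (E.enorm_le_of_abs_le (by positivity) (MeasFun.abs_lower_le _ (by positivity))))
    _ = ENNReal.ofReal r := by
      rw [← ENNReal.ofReal_add (by positivity) (by positivity), add_halves]

/-! ### The space `E` as a Banach space. -/

variable (E)

/-- The linear space of the functions that belong to `E`. -/
def submodule : Submodule ℝ MeasFun where
  carrier := {x | E.enorm x < ∞}
  zero_mem' := by simp [E.enorm_zero]
  add_mem' := fun hx hy => (E.enorm_add_le _ _).trans_lt (ENNReal.add_lt_top.2 ⟨hx, hy⟩)
  smul_mem' := fun c x hx => by
    change E.enorm (c • x) < ∞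
    rw [E.enorm_smul]
    exact ENNReal.mul_lt_top ENNReal.ofReal_lt_top hx

/-- The symmetric space `E` as a normed space. -/
def Space : Type := E.submodule

instance : AddCommGroup E.Space := inferInstanceAs (AddCommGroup E.submodule)
instance : Module ℝ E.Space := inferInstanceAs (Module ℝ E.submodule)
instance : Norm E.Space := ⟨fun x => (E.enorm x.1).toReal⟩

lemma norm_def (x : E.Space) : ‖x‖ = (E.enorm x.1).toReal := rfl

lemma normCore : NormedSpace.Core ℝ E.Space where
  norm_nonneg x := ENNReal.toReal_nonneg
  norm_smul c x := by
    rw [norm_def, norm_def, Real.norm_eq_abs, ← ENNReal.toReal_ofReal (abs_nonneg c),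
      ← ENNReal.toReal_mul, ← E.enorm_smul]
    rfl
  norm_triangle x y := by
    rw [norm_def, norm_def, norm_def, ← ENNReal.toReal_add x.2.ne y.2.ne]
    exact ENNReal.toReal_mono (ENNReal.add_ne_top.2 ⟨x.2.ne, y.2.ne⟩) (E.enorm_add_le x.1 y.1)
  norm_eq_zero_iff x := by
    rw [norm_def, ENNReal.toReal_eq_zero_iff]
    constructor
    · rintro (h | h)
      · exact Subtype.ext (E.enorm_eq_zero _ h)
      · exact absurd h x.2.ne
    · rintro rfl
      exact Or.inl E.enorm_zero

instance : NormedAddCommGroup E.Space := NormedAddCommGroup.ofCore E.normCore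
instance : NormedSpace ℝ E.Space := NormedSpace.ofCore E.normCore

lemma enorm_eq_ofReal_norm (x : E.Space) : E.enorm x.1 = ENNReal.ofReal ‖x‖ :=
  (ENNReal.ofReal_toReal x.2.ne).symm

instance : CompleteSpace E.Space := by
  refine Metric.complete_of_cauchySeq_tendsto fun u hu => ?_
  obtain ⟨x, hx, hlim⟩ := E.complete (fun n => (u n).1) (fun n => (u n).2) fun ε hε => by
    obtain ⟨r, hr0, hrε⟩ : ∃ r : ℝ, 0 < r ∧ ENNReal.ofReal r ≤ ε := by
      rcases eq_or_ne ε ∞ with rfl | hne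
      · exact ⟨1, one_pos, le_top⟩
      · exact ⟨ε.toReal, ENNReal.toReal_pos hε.ne' hne, ENNReal.ofReal_toReal_le⟩
    obtain ⟨N, hN⟩ := Metric.cauchySeq_iff.1 hu r hr0
    refine ⟨N, fun m hm n hn => lt_of_lt_of_le ?_ hrε⟩
    have h1 := hN m hm n hn
    rw [dist_eq_norm] at h1
    have h2 := E.enorm_eq_ofReal_norm (u m - u n)
    change E.enorm ((u m).1 - (u n).1) = _ at h2
    rw [h2]
    exact (ENNReal.ofReal_lt_ofReal_iff hr0).2 h1
  let y : E.Space := (⟨x, hx⟩ : E.submodule)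
  refine ⟨y, tendsto_iff_norm_sub_tendsto_zero.2 ?_⟩
  have := (ENNReal.tendsto_toReal ENNReal.zero_ne_top).comp hlim
  rw [ENNReal.toReal_zero] at this
  exact this

/-! ### Weak compactness of order intervals. -/

variable {E}

lemma memLp_of_abs_le {x : MeasFun} {M : ℝ} (hx : |x| ≤ M • (1 : MeasFun)) :
    x ∈ Lp ℝ 2 (volume : Measure I) := by
  rw [Lp.mem_Lp_iff_eLpNorm_lt_top]
  exact (MemLp.of_bound x.aestronglyMeasurable M
    ((MeasFun.abs_le_smul_one_iff.1 hx).mono fun t ht => by simpa using ht)).2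

/-- Elements of the order interval `[-M,M]` on which a functional of `E` is at least `c`, as a
subset of `L²`. -/
def orderIntervalSlice (M : ℝ) (φ : StrongDual ℝ E.Space) (c : ℝ) :
    Set (Lp ℝ 2 (volume : Measure I)) :=
  {z | ∃ y : E.Space, y.1 = z.1 ∧ |y.1| ≤ M • (1 : MeasFun) ∧ c ≤ φ y}

lemma convex_orderIntervalSlice (M : ℝ) (φ : StrongDual ℝ E.Space) (c : ℝ) :
    Convex ℝ (orderIntervalSlice M φ c) := by
  rintro z ⟨y, hyz, hyM, hyc⟩ z' ⟨y', hyz', hyM', hyc'⟩ a b ha hb hab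
  refine ⟨a • y + b • y', ?_, ?_, ?_⟩
  · change a • y.1 + b • y'.1 = a • z.1 + b • z'.1
    rw [hyz, hyz']
  · change |a • y.1 + b • y'.1| ≤ _
    rw [MeasFun.abs_le_smul_one_iff] at hyM hyM' ⊢
    filter_upwards [hyM, hyM', AEEqFun.coeFn_add (a • y.1) (b • y'.1), AEEqFun.coeFn_smul a y.1,
      AEEqFun.coeFn_smul b y'.1] with t h1 h2 h3 h4 h5
    rw [h3, Pi.add_apply, h4, h5, Pi.smul_apply, Pi.smul_apply, smul_eq_mul, smul_eq_mul]
    refine (abs_add_le _ _).trans ?_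
    rw [abs_mul, abs_mul, abs_of_nonneg ha, abs_of_nonneg hb]
    have hb' : b = 1 - a := by linarith
    subst hb'
    nlinarith
  · rw [map_add, map_smul, map_smul, smul_eq_mul, smul_eq_mul]
    have hb' : b = 1 - a := by linarith
    subst hb'
    nlinarith

/-- `L²` convergence implies convergence in measure, which on an order interval implies convergence
in `E`, so the inequality for `φ` survives. The bound `M` passes to the limit along an a.e.
convergent subsequence. -/
lemma isClosed_orderIntervalSlice (h : F.AbsContIncluded E) {M : ℝ} (hM : 0 ≤ M)
    (φ : StrongDual ℝ E.Space) (c : ℝ) : IsClosed (orderIntervalSlice M φ c) := by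
  refine IsSeqClosed.isClosed fun z z₀ hz hlim => ?_
  choose y hyz hyM hyc using hz
  have hmeas : TendstoInMeasure volume (fun n => (z n : I → ℝ)) atTop z₀ :=
    tendstoInMeasure_of_tendsto_Lp hlim
  have hM₀ : |z₀.1| ≤ M • (1 : MeasFun) := by
    rw [MeasFun.abs_le_smul_one_iff]
    obtain ⟨ns, -, hns⟩ := hmeas.exists_seq_tendsto_ae
    have hall : ∀ᵐ t, ∀ n, |(z n).1 t| ≤ M := ae_all_iff.2 fun n =>
      MeasFun.abs_le_smul_one_iff.1 (hyz n ▸ hyM n)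
    filter_upwards [hns, hall] with t h1 h2
    exact le_of_tendsto h1.abs (Eventually.of_forall fun n => h2 (ns n))
  have hfin : E.enorm z₀.1 < ∞ := (E.enorm_le_of_abs_le hM hM₀).trans_lt ENNReal.ofReal_lt_top
  let y₀ : E.Space := (⟨z₀.1, hfin⟩ : E.submodule)
  refine ⟨y₀, rfl, hM₀, ?_⟩
  have hE : Tendsto (fun n => E.enorm ((y n).1 - z₀.1)) atTop (𝓝 0) := by
    refine tendsto_enorm_of_tendstoInMeasure h (M := M + M) (by positivity) (fun n => ?_)
      fun ε hε => ?_
    · have h1 := hyM n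
      rw [MeasFun.abs_le_smul_one_iff] at h1 hM₀ ⊢
      filter_upwards [h1, hM₀, AEEqFun.coeFn_sub (y n).1 z₀.1] with t h1 h2 h3
      rw [h3, Pi.sub_apply]
      exact (abs_sub _ _).trans (add_le_add h1 h2)
    · refine tendsto_of_tendsto_of_tendsto_of_le_of_le tendsto_const_nhds
        ((tendstoInMeasure_iff_norm.1 hmeas) ε hε) (fun _ => zero_le) fun n => ?_
      refine measure_mono_ae ?_
      filter_upwards [AEEqFun.coeFn_sub (y n).1 z₀.1] with t h3
      intro h4
      change ε < |((y n).1 - z₀.1) t| at h4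
      rw [h3, hyz n] at h4
      exact h4.le
  have hy : Tendsto y atTop (𝓝 y₀) := by
    refine tendsto_iff_norm_sub_tendsto_zero.2 ?_
    have := (ENNReal.tendsto_toReal ENNReal.zero_ne_top).comp hE
    rw [ENNReal.toReal_zero] at this
    exact this
  exact ge_of_tendsto ((φ.continuous.tendsto _).comp hy) (Eventually.of_forall hyc)

/-- Order intervals `[-M,M]` are weakly compact in `E`. -/
lemma relWeaklyCompact_orderInterval (h : F.AbsContIncluded E) {M : ℝ} (hM : 0 ≤ M) :
    RelWeaklyCompact {x : E.Space | |x.1| ≤ M • (1 : MeasFun)} := by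
  classical
  intro U hU
  -- The value `0` off the order interval is irrelevant, since `U` contains the interval.
  let π : E.Space → Lp ℝ 2 (volume : Measure I) := fun x =>
    if hx : |x.1| ≤ M • (1 : MeasFun) then ⟨x.1, memLp_of_abs_le hx⟩ else 0
  have hπ : ∀ x : E.Space, |x.1| ≤ M • (1 : MeasFun) → (π x).1 = x.1 := fun x hx => by
    simp only [π, dif_pos hx]
  obtain ⟨x₀, hx₀⟩ := (isReflexive_of_inner.relWeaklyCompact
    (A := {z : Lp ℝ 2 (volume : Measure I) | ‖z‖ ≤ _}) (fun x hx => hx)).exists_weakLim U (u := π)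
    (mem_of_superset hU fun x hx => Lp.norm_le_of_ae_bound hM (by
      have := MeasFun.abs_le_smul_one_iff.1 hx
      rw [← hπ x hx] at this
      exact this))
  -- Slices are convex and closed in `L²`, so they contain the weak `L²` limit `x₀`. Every bound `c
  -- ≤ φ x` valid along `U` thus passes to `x₀`, although `φ` need not be continuous on `L²`.
  have key : ∀ (φ : StrongDual ℝ E.Space) (c : ℝ), (∀ᶠ x in (U : Filter E.Space), c ≤ φ x) →
      x₀ ∈ orderIntervalSlice M φ c := fun φ c hφ =>
    hx₀.mem_of_convex_closed (convex_orderIntervalSlice M φ c)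
      (isClosed_orderIntervalSlice h hM φ c) <| by
        filter_upwards [hU, hφ] with x hx hx'
        exact ⟨x, (hπ x hx).symm, hx, hx'⟩
  obtain ⟨y₀, hy₀, -, -⟩ := key 0 0 (by simp)
  have key' : ∀ (φ : StrongDual ℝ E.Space) (c : ℝ), (∀ᶠ x in (U : Filter E.Space), c ≤ φ x) →
      c ≤ φ y₀ := fun φ c hφ => by
    obtain ⟨y, hy, -, hyc⟩ := key φ c hφ
    have : y = y₀ := Subtype.ext (hy.trans hy₀.symm)
    rwa [← this]
  -- Along an ultrafilter, failure of a strict bound means the opposite bound holds eventually;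
  -- `key'` carries it to `y₀`.
  refine ⟨y₀, fun φ => tendsto_order.2 ⟨fun c hc => ?_, fun c hc => ?_⟩⟩
  · by_contra hcon
    have h1 := key' (-φ) (-c) ((Ultrafilter.eventually_not.2 hcon).mono fun x hx => by
      simpa using hx)
    simp only [neg_apply, neg_le_neg_iff] at h1
    exact absurd hc (not_lt.2 h1)
  · by_contra hcon
    have h1 := key' φ c ((Ultrafilter.eventually_not.2 hcon).mono fun x hx => by simpa using hx)
    exact absurd hc (not_lt.2 h1)

end SymmetricSpace

/-! ### Bounded completeness of the basis. -/

section Basis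

variable {W : Type*} [NormedAddCommGroup W] [NormedSpace ℝ W] {w : UnconditionalSchauderBasis ℕ ℝ W}

lemma unconditionalNorm_le_sum {c : ℕ → ℝ} {N : ℕ} (hc : ∀ i, N ≤ i → c i = 0) :
    unconditionalNorm w c ≤ ∑ i ∈ Finset.range N, |c i| * ‖w i‖ := by
  classical
  refine ciSup_le fun p => (norm_sum_le _ _).trans ?_
  have h1 : ∀ i, ‖((p.2 i : ℝ) * c i) • w i‖ ≤ |c i| * ‖w i‖ := fun i => by
    rw [norm_smul, norm_mul, Real.norm_eq_abs, Real.norm_eq_abs]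
    have : |(p.2 i : ℝ)| ≤ 1 := abs_le.2 (p.2 i).2
    gcongr
    exact mul_le_of_le_one_left (abs_nonneg _) this
  refine (Finset.sum_le_sum fun i _ => h1 i).trans ?_
  rw [← Finset.sum_filter_of_ne (p := fun i => i < N) fun i _ hi => by
    by_contra hN
    exact hi (by simp [hc i (not_lt.1 hN)])]
  exact Finset.sum_le_sum_of_subset_of_nonneg
    (fun i hi => Finset.mem_range.2 (Finset.mem_filter.1 hi).2) fun i _ _ => by positivity

/-- An unconditional basis of a weakly sequentially complete space is boundedly complete. -/
lemma summable_of_isWeaklySequentiallyComplete (hW : IsWeaklySequentiallyComplete W)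
    {c : ℕ → ℝ} {R : ℝ} (h : ∀ (A : Finset ℕ) (θ : ℕ → Icc (-1 : ℝ) 1),
      ‖∑ i ∈ A, ((θ i : ℝ) * c i) • w i‖ ≤ R) : Summable fun i => c i • w i := by
  -- Choosing `θ` as the signs of `φ (c i • w i)` bounds the sums of absolute values by `‖φ‖ * R`,
  -- so the partial sums are weakly Cauchy.
  have hsum : ∀ φ : StrongDual ℝ W, Summable fun i => φ (c i • w i) := fun φ => by
    refine Summable.of_abs (summable_of_sum_le (c := ‖φ‖ * R) (fun i => abs_nonneg _) fun A => ?_)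
    have hθ : ∀ i, ∃ θ : Icc (-1 : ℝ) 1, |φ (c i • w i)| = θ * φ (c i • w i) := fun i => by
      rcases le_total 0 (φ (c i • w i)) with h | h
      · exact ⟨⟨1, by norm_num⟩, by rw [abs_of_nonneg h, one_mul]⟩
      · exact ⟨⟨-1, by norm_num⟩, by rw [abs_of_nonpos h, neg_one_mul]⟩
    choose θ hθ using hθ
    have h1 : ∑ i ∈ A, |φ (c i • w i)| = φ (∑ i ∈ A, ((θ i : ℝ) * c i) • w i) := by
      rw [map_sum]
      refine Finset.sum_congr rfl fun i _ => ?_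
      rw [hθ, mul_smul, map_smul φ (θ i : ℝ), smul_eq_mul]
    rw [h1]
    exact (le_abs_self _).trans ((φ.le_opNorm _).trans (by gcongr; exact h A θ))
  have htend : ∀ φ : StrongDual ℝ W, Tendsto (fun n => φ (∑ i ∈ Finset.range n, c i • w i)) atTop
      (𝓝 (∑' i, φ (c i • w i))) := fun φ => by
    simp only [map_sum]
    exact (hsum φ).hasSum.tendsto_sum_nat
  obtain ⟨y, hy⟩ := hW _ fun φ => (htend φ).cauchySeq
  have hcoord : ∀ i, w.coord i y = c i := fun i => by
    rw [tendsto_nhds_unique (hy (w.coord i)) (htend (w.coord i)), tsum_eq_single i]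
    · simp [w.ortho]
    · intro j hj
      simp [w.ortho, hj.symm]
  have := w.expansion y
  simp only [hcoord] at this
  exact this.summable

end Basis

/-! ### Comparison of `k` with the norm of `E`. -/

namespace SymmetricSpace

variable {E F : SymmetricSpace}

lemma exists_enorm_le_mul_kFun (h : F.ContIncluded E) {a b : ℝ} (ha : 0 < a) (hb : 0 < b) :
    ∃ m : ℝ≥0, ∀ f, E.enorm f ≤ m * E.kFun F a b f := by
  obtain ⟨C, hC⟩ := h
  have ha' : ENNReal.ofReal a ≠ 0 := by simpa using ha
  have hb' : ENNReal.ofReal b ≠ 0 := by simpa using hb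
  -- `C + 1` instead of `C` keeps the factor nonzero, so that the bound is `∞` when `v ∉ F`.
  set m : ℝ≥0∞ := 1 / ENNReal.ofReal a + (C + 1) / ENNReal.ofReal b with hm
  have hmt : m ≠ ∞ := by simp [hm, ENNReal.div_eq_top, ha', hb']
  refine ⟨m.toNNReal, fun f => ?_⟩
  rw [ENNReal.coe_toNNReal hmt]
  have hm0 : m ≠ 0 := by simp [hm]
  have key : E.enorm f / m ≤ E.kFun F a b f := by
    refine le_iInf fun u => le_iInf fun v => le_iInf fun huv => ?_
    subst huv
    rw [ENNReal.div_le_iff_le_mul (Or.inl hm0) (Or.inl hmt), add_mul]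
    refine (E.enorm_add_le _ _).trans (add_le_add ?_ ?_)
    · calc E.enorm u = ENNReal.ofReal a * E.enorm u * (1 / ENNReal.ofReal a) := by
            rw [mul_comm (ENNReal.ofReal a), mul_assoc, one_div,
              ENNReal.mul_inv_cancel ha' ENNReal.ofReal_ne_top, mul_one]
        _ ≤ _ := by gcongr; exact le_self_add
    · calc E.enorm v ≤ (C + 1) * F.enorm v := by
            by_cases hv : F.enorm v < ∞
            · exact (hC v hv).trans (by gcongr; exact le_self_add)
            · rw [not_lt, top_le_iff] at hv
              rw [hv, ENNReal.mul_top (by simp)]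
              exact le_top
        _ = ENNReal.ofReal b * F.enorm v * ((C + 1) / ENNReal.ofReal b) := by
            rw [mul_comm (ENNReal.ofReal b), mul_assoc, ENNReal.mul_div_cancel hb'
              ENNReal.ofReal_ne_top, mul_comm]
        _ ≤ _ := by gcongr; exact le_add_self
  rwa [ENNReal.div_le_iff_le_mul (Or.inl hm0) (Or.inl hmt), mul_comm] at key

lemma kFun_le_enorm (a b : ℝ) (f : MeasFun) :
    E.kFun F a b f ≤ ENNReal.ofReal a * E.enorm f := by
  simpa [enorm_zero] using E.kFun_le F a b f 0

end SymmetricSpace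

/-! ### The `W`-direct sum and the gliding hump. -/

namespace PeetreData

variable {W : Type*} [NormedAddCommGroup W] [NormedSpace ℝ W] (D : PeetreData W)

variable {D} in
lemma kFun_lt_top (x : D.E.Space) (i : ℕ) : D.E.kFun D.F (D.a i) (D.b i) x.1 < ∞ :=
  (SymmetricSpace.kFun_le_enorm _ _ _).trans_lt (ENNReal.mul_lt_top ENNReal.ofReal_lt_top x.2)

/-- The functional `k(·;aᵢ,bᵢ)` on `E`. -/
def kNorm (i : ℕ) (x : D.E.Space) : ℝ := D.kSeq x.1 i

variable {D}

lemma kNorm_nonneg (i : ℕ) (x : D.E.Space) : 0 ≤ D.kNorm i x := ENNReal.toReal_nonneg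

lemma kNorm_smul (i : ℕ) (c : ℝ) (x : D.E.Space) : D.kNorm i (c • x) = |c| * D.kNorm i x :=
  kSeq_smul c x.1 i

@[simp] lemma kNorm_zero (i : ℕ) : D.kNorm i 0 = 0 := by
  simpa using kNorm_smul i 0 (0 : D.E.Space)

lemma kNorm_add_le (i : ℕ) (x y : D.E.Space) :
    D.kNorm i (x + y) ≤ D.kNorm i x + D.kNorm i y := by
  unfold kNorm kSeq
  rw [← ENNReal.toReal_add (kFun_lt_top x i).ne (kFun_lt_top y i).ne]
  exact ENNReal.toReal_mono (ENNReal.add_ne_top.2 ⟨(kFun_lt_top x i).ne, (kFun_lt_top y i).ne⟩)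
    (SymmetricSpace.kFun_add_le _ _ _ _ _ _)

lemma kNorm_le (i : ℕ) (x : D.E.Space) : D.kNorm i x ≤ D.a i * ‖x‖ := by
  refine ENNReal.toReal_le_of_le_ofReal (mul_nonneg (D.a_pos i).le (norm_nonneg _)) ?_
  rw [ENNReal.ofReal_mul (D.a_pos i).le, ← D.E.enorm_eq_ofReal_norm]
  exact SymmetricSpace.kFun_le_enorm _ _ _

lemma eq_zero_of_kNorm_eq_zero {i : ℕ} {x : D.E.Space} (h : D.kNorm i x = 0) : x = 0 := by
  refine Subtype.ext (SymmetricSpace.kFun_eq_zero D.absCont.1 (D.a_pos i) (D.b_pos i) ?_)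
  rcases (ENNReal.toReal_eq_zero_iff _).1 h with h3 | h3
  · exact h3
  · exact absurd h3 (kFun_lt_top x i).ne

variable [CompleteSpace W] (D)

/-- The sequences `x` in `E` for which `∑ k(xᵢ;aᵢ,bᵢ) wᵢ` converges. -/
def seqSubmodule : Submodule ℝ (ℕ → D.E.Space) where
  carrier := {x | Summable fun i => D.kNorm i (x i) • D.w i}
  zero_mem' := by simp [summable_zero]
  add_mem' := fun {x y} hx hy => by
    have h : Summable fun i => (D.kNorm i (x i) + D.kNorm i (y i)) • D.w i := by
      simp only [add_smul]
      exact hx.add hy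
    refine summable_of_abs_le h fun i => ?_
    rw [abs_of_nonneg (kNorm_nonneg _ _),
      abs_of_nonneg (add_nonneg (kNorm_nonneg _ _) (kNorm_nonneg _ _))]
    exact kNorm_add_le i _ _
  smul_mem' := fun c x hx => by
    change Summable fun i => D.kNorm i (c • x i) • D.w i
    simp only [kNorm_smul, mul_smul]
    exact hx.const_smul _

/-- The `W`-direct sum of the spaces `(E + F, k(·;aᵢ,bᵢ))`. -/
def SeqSpace : Type := D.seqSubmodule

instance : AddCommGroup D.SeqSpace := inferInstanceAs (AddCommGroup D.seqSubmodule)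
instance : Module ℝ D.SeqSpace := inferInstanceAs (Module ℝ D.seqSubmodule)
instance : Norm D.SeqSpace := ⟨fun x => unconditionalNorm D.w fun i => D.kNorm i (x.1 i)⟩

variable {D}

lemma SeqSpace.norm_def (x : D.SeqSpace) :
    ‖x‖ = unconditionalNorm D.w fun i => D.kNorm i (x.1 i) := rfl

lemma SeqSpace.norm_le_of_kNorm_le {x y : D.SeqSpace}
    (h : ∀ i, D.kNorm i (x.1 i) ≤ D.kNorm i (y.1 i)) : ‖x‖ ≤ ‖y‖ :=
  unconditionalNorm_mono y.2 fun i => by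
    rw [abs_of_nonneg (kNorm_nonneg _ _), abs_of_nonneg (kNorm_nonneg _ _)]
    exact h i

variable (D)

lemma seqNormCore : NormedSpace.Core ℝ D.SeqSpace where
  norm_nonneg x := unconditionalNorm_nonneg _
  norm_smul c x := by
    have h : (fun i => D.kNorm i ((c • x).1 i)) = fun i => |c| * D.kNorm i (x.1 i) :=
      funext fun i => kNorm_smul i c (x.1 i)
    rw [SeqSpace.norm_def, SeqSpace.norm_def, h, unconditionalNorm_smul, abs_abs,
      Real.norm_eq_abs]
  norm_triangle x y := by
    have h : Summable fun i => (D.kNorm i (x.1 i) + D.kNorm i (y.1 i)) • D.w i := by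
      simp only [add_smul]
      exact x.2.add y.2
    refine (unconditionalNorm_mono h fun i => ?_).trans (unconditionalNorm_add_le x.2 y.2)
    rw [abs_of_nonneg (kNorm_nonneg _ _),
      abs_of_nonneg (add_nonneg (kNorm_nonneg _ _) (kNorm_nonneg _ _))]
    exact kNorm_add_le i _ _
  norm_eq_zero_iff x := by
    constructor
    · intro h
      refine Subtype.ext (funext fun i => ?_)
      have h0 := norm_sum_le_unconditionalNorm x.2 {i}
      rw [Finset.sum_singleton, norm_smul] at h0
      obtain ⟨c, C, hc, hC⟩ := D.seminormalized
      have hw : ‖D.w i‖ ≠ 0 := (hc.trans_le (hC i).1).ne'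
      have h1 : ‖D.kNorm i (x.1 i)‖ * ‖D.w i‖ = 0 := le_antisymm (h0.trans_eq h) (by positivity)
      exact eq_zero_of_kNorm_eq_zero (i := i) (by simpa [hw] using h1)
    · rintro rfl
      refine le_antisymm ((unconditionalNorm_le_sum (N := 0) fun i _ => ?_).trans_eq (by simp))
        (unconditionalNorm_nonneg _)
      exact kNorm_zero i

instance : NormedAddCommGroup D.SeqSpace := NormedAddCommGroup.ofCore D.seqNormCore
instance : NormedSpace ℝ D.SeqSpace := NormedSpace.ofCore D.seqNormCore

namespace SeqSpace

/-- Coordinatewise multiplication by a sequence of numbers in `[-1,1]`. -/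
def mul (θ : ℕ → Icc (-1 : ℝ) 1) : D.SeqSpace →L[ℝ] D.SeqSpace :=
  have hk : ∀ (x : ℕ → D.E.Space) i, D.kNorm i ((θ i : ℝ) • x i) ≤ D.kNorm i (x i) := fun x i => by
    rw [kNorm_smul]
    exact mul_le_of_le_one_left (kNorm_nonneg _ _) (abs_le.2 (θ i).2)
  LinearMap.mkContinuous (E := D.SeqSpace) (F := D.SeqSpace)
    { toFun := fun x => (⟨fun i => (θ i : ℝ) • x.1 i, summable_of_abs_le x.2 fun i => by
        rw [abs_of_nonneg (kNorm_nonneg _ _), abs_of_nonneg (kNorm_nonneg _ _)]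
        exact hk x.1 i⟩ : D.seqSubmodule)
      map_add' := fun x y => Subtype.ext (funext fun i => smul_add _ _ _)
      map_smul' := fun c x => Subtype.ext (funext fun i => smul_comm (θ i : ℝ) c (x.1 i)) } 1
    fun x => by
      rw [one_mul]
      exact norm_le_of_kNorm_le (hk x.1)

/-- Projection onto the first `N` coordinates. -/
def trunc (N : ℕ) : D.SeqSpace →L[ℝ] D.SeqSpace :=
  mul D fun i => if i < N then ⟨1, by norm_num⟩ else ⟨0, by norm_num⟩

variable {D}

lemma mul_apply (θ : ℕ → Icc (-1 : ℝ) 1) (x : D.SeqSpace) (i : ℕ) :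
    (mul D θ x).1 i = (θ i : ℝ) • x.1 i := rfl

lemma add_apply (x y : D.SeqSpace) (i : ℕ) : (x + y).1 i = x.1 i + y.1 i := rfl
lemma sub_apply (x y : D.SeqSpace) (i : ℕ) : (x - y).1 i = x.1 i - y.1 i := rfl
lemma smul_apply (c : ℝ) (x : D.SeqSpace) (i : ℕ) : (c • x).1 i = c • x.1 i := rfl

lemma trunc_apply (N : ℕ) (x : D.SeqSpace) (i : ℕ) :
    (trunc D N x).1 i = if i < N then x.1 i else 0 := by
  rw [trunc, mul_apply]
  split_ifs <;> simp

lemma tendsto_sub_trunc (x : D.SeqSpace) :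
    Tendsto (fun N => ‖x - trunc D N x‖) atTop (𝓝 0) := by
  classical
  rw [Metric.tendsto_atTop]
  intro ε hε
  obtain ⟨s, hs⟩ := summable_iff_vanishing_norm.1 x.2 (ε / 3) (by positivity)
  -- Indices from here on miss `s`; the factor `2` below is the cost of passing from subset sums to
  -- multipliers.
  refine ⟨s.sup id + 1, fun N hN => ?_⟩
  rw [Real.dist_eq, sub_zero, abs_of_nonneg (norm_nonneg _)]
  have hcoef : ∀ i, (x - trunc D N x).1 i = if i < N then 0 else x.1 i := fun i => by
    rw [sub_apply, trunc_apply]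
    split_ifs <;> simp
  refine lt_of_le_of_lt (ciSup_le fun p => ?_) (by linarith : 2 * (ε / 3) < ε)
  have := norm_theta_sum_le (x := fun i => D.kNorm i ((x - trunc D N x).1 i) • D.w i) (M := ε / 3)
    (fun A => by
      have h := hs (A.filter fun i => ¬ i < N) (Finset.disjoint_left.2 fun i hi his => by
        have h1 := Finset.le_sup (f := id) his
        simp only [id] at h1
        have h2 := (Finset.mem_filter.1 hi).2
        omega)
      refine le_trans (le_of_eq ?_) h.le
      rw [Finset.sum_filter]
      congr 1
      refine Finset.sum_congr rfl fun i _ => ?_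
      rw [hcoef]
      split_ifs <;> simp) p.1 p.2
  simpa only [smul_smul] using this

/-- A gliding hump argument: in `D.SeqSpace` a weakly Cauchy sequence with vanishing coordinates
is weakly null, since otherwise a change of signs on consecutive blocks spoils the convergence. -/
lemma weakLim_zero_of_trunc {z : ℕ → D.SeqSpace}
    (hz : ∀ N, Tendsto (fun m => ‖trunc D N (z m)‖) atTop (𝓝 0))
    (hcau : ∀ φ : StrongDual ℝ D.SeqSpace, CauchySeq fun m => φ (z m)) :
    WeakLim atTop z 0 := by
  classical
  -- Up to `1/(k+1)` at either end, `z m` lives on the block of coordinates from `N` to `N'`.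
  have hstep : ∀ k N : ℕ, ∃ m N', k ≤ m ∧ N < N' ∧ ‖trunc D N (z m)‖ < 1 / ((k : ℝ) + 1) ∧
      ‖z m - trunc D N' (z m)‖ < 1 / ((k : ℝ) + 1) := fun k N => by
    have hk : 0 < 1 / ((k : ℝ) + 1) := by positivity
    obtain ⟨m, hm, hkm⟩ := (((hz N).eventually (gt_mem_nhds hk)).and (eventually_ge_atTop k)).exists
    obtain ⟨N', hN', hNN'⟩ := (((tendsto_sub_trunc (z m)).eventually (gt_mem_nhds hk)).and
      (eventually_gt_atTop N)).exists
    exact ⟨m, N', hkm, hNN', hm, hN'⟩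
  choose m N' hkm hlt hhead htail using hstep
  let N : ℕ → ℕ := fun k => Nat.rec (motive := fun _ => ℕ) 0 (fun k n => N' k n) k
  have hN : ∀ k, N (k + 1) = N' k (N k) := fun k => rfl
  have hmono : StrictMono N := strictMono_nat_of_lt_succ fun k => by
    rw [hN]
    exact hlt _ _
  let M : ℕ → ℕ := fun k => m k (N k)
  have hM : Tendsto M atTop atTop := tendsto_atTop_mono (fun k => hkm _ _) tendsto_id
  let θ : ℕ → Icc (-1 : ℝ) 1 := fun i =>
    if ∃ k : ℕ, Even k ∧ N k ≤ i ∧ i < N (k + 1) then ⟨1, by norm_num⟩ else ⟨-1, by norm_num⟩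
  have hθ : ∀ k i, N k ≤ i → i < N (k + 1) → (θ i : ℝ) = (-1) ^ k := fun k i h1 h2 => by
    have huniq : ∀ l, N l ≤ i → i < N (l + 1) → l = k := fun l h3 h4 => by
      have h5 : k < l + 1 := hmono.lt_iff_lt.1 (h1.trans_lt h4)
      have h6 : l < k + 1 := hmono.lt_iff_lt.1 (h3.trans_lt h2)
      omega
    rcases Nat.even_or_odd k with hk | hk
    · have : ∃ k, Even k ∧ N k ≤ i ∧ i < N (k + 1) := ⟨k, hk, h1, h2⟩
      simp [θ, this, hk.neg_one_pow]
    · have : ¬ ∃ k, Even k ∧ N k ≤ i ∧ i < N (k + 1) := by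
        rintro ⟨l, hl, h3, h4⟩
        rw [huniq l h3 h4] at hl
        exact Nat.not_even_iff_odd.2 hk hl
      simp only [θ, this, if_false, hk.neg_one_pow]
  -- On block `k` the multiplier is exactly `(-1)^k`. Elsewhere it differs by at most `2`, and there
  -- only the small head and tail contribute.
  have hS : ∀ k, ‖mul D θ (z (M k)) - (-1 : ℝ) ^ k • z (M k)‖ ≤ 4 * (1 / ((k : ℝ) + 1)) := by
    intro k
    set x := z (M k) with hx
    have h1 : ‖mul D θ x - (-1 : ℝ) ^ k • x‖ ≤
        ‖(2 : ℝ) • trunc D (N k) x + (2 : ℝ) • (x - trunc D (N (k + 1)) x)‖ := by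
      refine norm_le_of_kNorm_le fun i => ?_
      rw [sub_apply, mul_apply, smul_apply, add_apply, smul_apply, smul_apply, sub_apply,
        trunc_apply, trunc_apply, ← sub_smul, kNorm_smul]
      have h2 : |(θ i : ℝ) - (-1) ^ k| ≤ 2 := by
        have h3 : |(θ i : ℝ)| ≤ 1 := abs_le.2 (θ i).2
        have h4 : |(-1 : ℝ) ^ k| = 1 := by simp
        linarith [abs_sub (θ i : ℝ) ((-1) ^ k)]
      have h3 : D.kNorm i ((2 : ℝ) • x.1 i) = 2 * D.kNorm i (x.1 i) := by
        rw [kNorm_smul]; simp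
      have h4 := mul_le_mul_of_nonneg_right h2 (kNorm_nonneg i (x.1 i))
      have h5 : N k < N (k + 1) := hmono (Nat.lt_succ_self k)
      by_cases hi : i < N k
      · rw [if_pos hi, if_pos (hi.trans h5), sub_self, smul_zero, add_zero, h3]
        exact h4
      · by_cases hi' : i < N (k + 1)
        · rw [hθ k i (not_lt.1 hi) hi']
          simpa using kNorm_nonneg _ _
        · rw [if_neg hi, if_neg hi', sub_zero, smul_zero, zero_add, h3]
          exact h4
    refine h1.trans ((norm_add_le _ _).trans ?_)
    rw [norm_smul, norm_smul, Real.norm_eq_abs, abs_two]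
    have h6 : ‖trunc D (N k) x‖ < _ := hhead k (N k)
    have h7 : ‖x - trunc D (N (k + 1)) x‖ < _ := htail k (N k)
    linarith
  intro φ
  obtain ⟨c, hc⟩ := cauchySeq_tendsto_of_complete (hcau φ)
  obtain ⟨c', hc'⟩ := cauchySeq_tendsto_of_complete (hcau (φ.comp (mul D θ)))
  have hdiff : Tendsto (fun k => φ (mul D θ (z (M k))) - (-1) ^ k * φ (z (M k))) atTop (𝓝 0) := by
    refine squeeze_zero_norm (a := fun k : ℕ => ‖φ‖ * (4 * (1 / ((k : ℝ) + 1)))) (fun k => ?_) ?_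
    · have : φ (mul D θ (z (M k))) - (-1) ^ k * φ (z (M k)) =
          φ (mul D θ (z (M k)) - (-1 : ℝ) ^ k • z (M k)) := by
        rw [map_sub, map_smul φ, smul_eq_mul]
      rw [this]
      exact (φ.le_opNorm _).trans (by gcongr; exact hS k)
    · simpa using (tendsto_one_div_add_atTop_nhds_zero_nat (𝕜 := ℝ)).const_mul 4 |>.const_mul ‖φ‖
  -- Since `φ ∘ mul θ` is again a functional, the alternating sequence converges too. Its even and
  -- odd subsequences tend to `c` and `-c`, so `c = 0`.
  have hsign : Tendsto (fun k => (-1 : ℝ) ^ k * φ (z (M k))) atTop (𝓝 c') := by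
    simpa using (hc'.comp hM).sub hdiff
  have h2 : Tendsto (fun k : ℕ => 2 * k) atTop atTop :=
    tendsto_id.const_mul_atTop' (by norm_num)
  have h3 : Tendsto (fun k : ℕ => 2 * k + 1) atTop atTop := 
    tendsto_atTop_mono (fun k => by omega) h2
  have heven : c = c' := tendsto_nhds_unique ((hc.comp hM).comp h2) (by
    have := hsign.comp h2
    simpa [Function.comp_def, pow_mul] using this)
  have hodd : -c = c' := tendsto_nhds_unique ((hc.comp hM).comp h3).neg (by
    have := hsign.comp h3
    simpa [Function.comp_def, pow_mul, pow_succ] using this)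
  have : c = 0 := by linarith
  rw [map_zero, ← this]
  exact hc

end SeqSpace

end PeetreData

/-- Preimages of balls under `φ` are convex, so one containing a tail of `y` contains its convex
hull. -/
lemma tendsto_of_mem_convexHull_tail {X : Type*} [NormedAddCommGroup X] [NormedSpace ℝ X]
    {y z : ℕ → X} (hz : ∀ m, z m ∈ convexHull ℝ (y '' Ici m)) (φ : StrongDual ℝ X) {c : ℝ}
    (h : Tendsto (fun n => φ (y n)) atTop (𝓝 c)) : Tendsto (fun m => φ (z m)) atTop (𝓝 c) := by
  rw [Metric.tendsto_atTop] at h ⊢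
  intro ε hε
  obtain ⟨N, hN⟩ := h ε hε
  refine ⟨N, fun m hm => ?_⟩
  have hsub : convexHull ℝ (y '' Ici m) ⊆ φ.toLinearMap ⁻¹' Metric.ball c ε :=
    convexHull_min (by
      rintro _ ⟨n, hn, rfl⟩
      exact hN n (le_trans hm hn)) ((convex_ball c ε).linear_preimage φ.toLinearMap)
  exact hsub (hz m)

/-! ### Embeddings of the Peetre space and the two conclusions. -/

namespace PeetreData

variable {W : Type*} [NormedAddCommGroup W] [NormedSpace ℝ W] [CompleteSpace W] {D : PeetreData W}

lemma norm_mul_gauge_one (f : D.Space) : ‖f‖ * D.gauge 1 = D.gauge f.1 := by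
  rw [norm_def, div_mul_cancel₀ _ gauge_one_pos.ne']

/-- A single term is bounded by the whole norm, and `inf ‖wᵢ‖ > 0` makes `C` independent of `i`.
This uniformity is what lets `aᵢ → ∞` take effect. -/
lemma exists_kSeq_le : ∃ C : ℝ, 0 ≤ C ∧ ∀ (f : D.Space) (i : ℕ), D.kSeq f.1 i ≤ C * ‖f‖ := by
  obtain ⟨c, C, hc, hC⟩ := D.seminormalized
  refine ⟨D.gauge 1 / c, div_nonneg gauge_one_pos.le hc.le, fun f i => ?_⟩
  have h0 := norm_sum_le_unconditionalNorm f.2.2 {i}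
  rw [Finset.sum_singleton, norm_smul, Real.norm_of_nonneg (kSeq_nonneg _ _)] at h0
  have h1 : D.kSeq f.1 i * c ≤ ‖f‖ * D.gauge 1 := by
    rw [norm_mul_gauge_one]
    exact (mul_le_mul_of_nonneg_left (hC i).1 (kSeq_nonneg _ _)).trans h0
  rw [div_mul_eq_mul_div, le_div_iff₀ hc, mul_comm (D.gauge 1)]
  exact h1

lemma enorm_lt_top_of_memK {f : MeasFun} (hf : D.MemK f) : D.E.enorm f < ∞ := by
  obtain ⟨m, hm⟩ := SymmetricSpace.exists_enorm_le_mul_kFun D.absCont.1 (D.a_pos 0) (D.b_pos 0)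
  exact (hm f).trans_lt (ENNReal.mul_lt_top ENNReal.coe_lt_top (hf.1 0))

variable (D)

/-- The inclusion of the Peetre space into `E`. -/
def toE : D.Space →L[ℝ] D.E.Space :=
  LinearMap.mkContinuousOfExistsBound (E := D.Space) (F := D.E.Space)
    { toFun := fun f => (⟨f.1, enorm_lt_top_of_memK f.2⟩ : D.E.submodule)
      map_add' := fun _ _ => rfl
      map_smul' := fun _ _ => rfl } <| by
    obtain ⟨m, hm⟩ := SymmetricSpace.exists_enorm_le_mul_kFun D.absCont.1 (D.a_pos 0) (D.b_pos 0)
    obtain ⟨C, -, hC⟩ := exists_kSeq_le (D := D)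
    refine ⟨m * C, fun f => ?_⟩
    have h1 : (D.E.enorm f.1).toReal ≤ m * D.kSeq f.1 0 := by
      have := ENNReal.toReal_mono (ENNReal.mul_lt_top ENNReal.coe_lt_top (f.2.1 0)).ne (hm f.1)
      rwa [ENNReal.toReal_mul] at this
    refine h1.trans ?_
    rw [mul_assoc]
    gcongr
    exact hC f 0

/-- The diagonal embedding of the Peetre space. -/
def diag : D.Space →L[ℝ] D.SeqSpace :=
  LinearMap.mkContinuous (E := D.Space) (F := D.SeqSpace)
    { toFun := fun f => (⟨fun _ => D.toE f, f.2.2⟩ : D.seqSubmodule)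
      map_add' := fun f g => Subtype.ext (funext fun _ => map_add D.toE f g)
      map_smul' := fun c f => Subtype.ext (funext fun _ => map_smul D.toE c f) } (D.gauge 1)
    fun f => by
      rw [mul_comm, norm_mul_gauge_one]
      exact le_rfl

lemma norm_diag (f : D.Space) : ‖D.diag f‖ = D.gauge 1 * ‖f‖ := by
  rw [mul_comm, norm_mul_gauge_one]
  rfl

/-- The diagonal embedding of `E`, truncated to the first `N` coordinates. -/
def diagTrunc (N : ℕ) : D.E.Space →L[ℝ] D.SeqSpace :=
  LinearMap.mkContinuous (E := D.E.Space) (F := D.SeqSpace)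
    { toFun := fun x => (⟨fun i => if i < N then x else 0, summable_of_ne_finset_zero
        (s := Finset.range N) fun i hi => by
          rw [Finset.mem_range] at hi
          simp [hi]⟩ : D.seqSubmodule)
      map_add' := fun x y => Subtype.ext (funext fun i => by
        change (if i < N then x + y else 0) = (if i < N then x else 0) + if i < N then y else 0
        split_ifs
        exacts [rfl, (add_zero 0).symm])
      map_smul' := fun c x => Subtype.ext (funext fun i => by
        change (if i < N then c • x else 0) = c • if i < N then x else 0
        split_ifs
        exacts [rfl, (smul_zero c).symm]) } (∑ i ∈ Finset.range N, D.a i * ‖D.w i‖)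
    fun x => by
      refine (unconditionalNorm_le_sum (N := N) fun i hi => ?_).trans ?_
      · change D.kNorm i (if i < N then x else 0) = 0
        rw [if_neg (not_lt.2 hi), kNorm_zero]
      · rw [Finset.sum_mul]
        refine Finset.sum_le_sum fun i hi => ?_
        rw [abs_of_nonneg (kNorm_nonneg _ _), mul_right_comm]
        gcongr
        change D.kNorm i (if i < N then x else 0) ≤ _
        rw [if_pos (Finset.mem_range.1 hi)]
        exact kNorm_le i x

variable {D}

lemma diagTrunc_apply (N : ℕ) (x : D.E.Space) (i : ℕ) :
    (D.diagTrunc N x).1 i = if i < N then x else 0 := rfl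

lemma trunc_diag (N : ℕ) (f : D.Space) :
    SeqSpace.trunc D N (D.diag f) = D.diagTrunc N (D.toE f) := by
  refine Subtype.ext (funext fun i => ?_)
  rw [SeqSpace.trunc_apply, diagTrunc_apply]
  rfl

lemma norm_trunc_le (N : ℕ) (x : D.SeqSpace) : ‖SeqSpace.trunc D N x‖ ≤ ‖x‖ :=
  SeqSpace.norm_le_of_kNorm_le fun i => by
    rw [SeqSpace.trunc_apply]
    split_ifs
    · exact le_rfl
    · simpa using kNorm_nonneg _ _

lemma norm_sub_trunc_le (N : ℕ) (x : D.SeqSpace) : ‖x - SeqSpace.trunc D N x‖ ≤ ‖x‖ :=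
  SeqSpace.norm_le_of_kNorm_le fun i => by
    rw [SeqSpace.sub_apply, SeqSpace.trunc_apply]
    split_ifs
    · simpa using kNorm_nonneg _ _
    · simp

/-- `diag` multiplies norms by the positive constant `D.gauge 1`, so `φ` is bounded on its range and
Hahn–Banach applies. -/
lemma exists_extension_diag (φ : StrongDual ℝ D.Space) :
    ∃ ψ : StrongDual ℝ D.SeqSpace, ∀ f, ψ (D.diag f) = φ f := by
  have hinj : Function.Injective D.diag.toLinearMap := by
    rw [← LinearMap.ker_eq_bot, LinearMap.ker_eq_bot']
    intro f hf
    have h1 : ‖D.diag f‖ = 0 := by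
      rw [norm_eq_zero]
      exact hf
    rw [norm_diag] at h1
    exact norm_eq_zero.1 ((mul_eq_zero.1 h1).resolve_left gauge_one_pos.ne')
  let e := LinearEquiv.ofInjective D.diag.toLinearMap hinj
  let φ' : StrongDual ℝ (LinearMap.range D.diag.toLinearMap) :=
    LinearMap.mkContinuous (φ.toLinearMap.comp e.symm.toLinearMap) (‖φ‖ / D.gauge 1) fun x => by
      obtain ⟨f, rfl⟩ := e.surjective x
      have h1 : ‖e f‖ = D.gauge 1 * ‖f‖ := norm_diag D f
      have h2 : (φ.toLinearMap.comp e.symm.toLinearMap) (e f) = φ f := by simp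
      rw [h2, h1, ← mul_assoc, div_mul_cancel₀ _ gauge_one_pos.ne']
      exact φ.le_opNorm f
  obtain ⟨ψ, hψ, -⟩ := exists_extension_norm_eq _ φ'
  refine ⟨ψ, fun f => (hψ (e f)).trans ?_⟩
  change φ (e.symm (e f)) = φ f
  rw [e.symm_apply_apply]

/-- Bounded sets of the Peetre space are relatively weakly compact in `E`. -/
lemma relWeaklyCompact_image_toE (R : ℝ) :
    RelWeaklyCompact (D.toE '' Metric.closedBall 0 R) := by
  refine relWeaklyCompact_of_approx fun ε hε => ?_
  obtain ⟨C, hC0, hC⟩ := exists_kSeq_le (D := D)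
  set r := C * |R| + 1 with hr
  have hr0 : 0 < r := by positivity
  -- One index `i` serves the whole ball: the part in `E` has norm at most `r / aᵢ ≤ ε / 2`, the
  -- part in `F` at most `r / bᵢ`. The level `M` is then chosen for that ball of `F`.
  obtain ⟨i, hi⟩ := (D.a_tendsto.eventually (eventually_ge_atTop (r / (ε / 2)))).exists
  have ha := D.a_pos i
  have hb := D.b_pos i
  have hai : r / D.a i ≤ ε / 2 := by
    rw [div_le_iff₀ (by positivity)] at hi
    rw [div_le_iff₀ ha]
    linarith
  obtain ⟨M, hM, hMF⟩ := SymmetricSpace.exists_enorm_upper_le D.absCont (div_pos hr0 hb)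
    (half_pos hε)
  refine ⟨_, SymmetricSpace.relWeaklyCompact_orderInterval D.absCont hM, ?_⟩
  rintro _ ⟨f, hf, rfl⟩
  have hfR : ‖f‖ ≤ |R| := (by simpa using hf : ‖f‖ ≤ R).trans (le_abs_self R)
  have hk : D.E.kFun D.F (D.a i) (D.b i) f.1 < ENNReal.ofReal r := by
    rw [ENNReal.lt_ofReal_iff_toReal_lt (f.2.1 i).ne]
    have h1 := hC f i
    have h2 : C * ‖f‖ ≤ C * |R| := by gcongr
    change D.kSeq f.1 i < r
    linarith
  simp only [SymmetricSpace.kFun, iInf_lt_iff] at hk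
  obtain ⟨u, v, huv, hlt⟩ := hk
  have hu : D.E.enorm u ≤ ENNReal.ofReal (ε / 2) := by
    refine le_trans ?_ (ENNReal.ofReal_le_ofReal hai)
    rw [ENNReal.ofReal_div_of_pos ha, ENNReal.le_div_iff_mul_le
      (Or.inl (by simpa using ha)) (Or.inl ENNReal.ofReal_ne_top), mul_comm]
    exact le_self_add.trans hlt.le
  have hv : D.F.enorm v ≤ ENNReal.ofReal (r / D.b i) := by
    rw [ENNReal.ofReal_div_of_pos hb, ENNReal.le_div_iff_mul_le
      (Or.inl (by simpa using hb)) (Or.inl ENNReal.ofReal_ne_top), mul_comm]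
    exact le_add_self.trans hlt.le
  have hlow := v.abs_lower_le hM
  let y : D.E.Space := (⟨v.lower M, (D.E.enorm_le_of_abs_le hM hlow).trans_lt
    ENNReal.ofReal_lt_top⟩ : D.E.submodule)
  refine ⟨y, hlow, ENNReal.toReal_le_of_le_ofReal hε.le ?_⟩
  -- The error consists of the `E`-part `u` and the part of `v` above `M`, each at most `ε / 2`.
  have h1 : (D.toE f - y).1 = u + v.upper M := by
    change f.1 - v.lower M = _
    rw [← huv, sub_eq_iff_eq_add, add_assoc, v.upper_add_lower]
  rw [h1]
  calc _ ≤ ENNReal.ofReal (ε / 2) + ENNReal.ofReal (ε / 2) :=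
        (D.E.enorm_add_le _ _).trans (add_le_add hu (hMF v hv))
    _ = ENNReal.ofReal ε := by
      rw [← ENNReal.ofReal_add (by positivity) (by positivity), add_halves]

/-- If `W` is weakly sequentially complete, then the balls of the Peetre space are closed in `E`
under weak limits, up to the value of the radius. -/
lemma exists_toE_eq_of_weakLim (hW : IsWeaklySequentiallyComplete W) {ι : Type*} {l : Filter ι}
    [l.NeBot] {u : ι → D.Space} {R : ℝ} (hu : ∀ᶠ i in l, ‖u i‖ ≤ R) {x : D.E.Space}
    (hx : WeakLim l (fun i => D.toE (u i)) x) : ∃ f : D.Space, D.toE f = x := by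
  -- `diagTrunc N` is bounded on `E`, so the uniform bound on truncations passes to the weak limit;
  -- bounded completeness then gives the full series.
  have hbound : ∀ N, ‖D.diagTrunc N x‖ ≤ D.gauge 1 * R := fun N =>
    (hx.comp (D.diagTrunc N)).norm_le <| hu.mono fun i hi => by
      rw [← trunc_diag]
      refine (norm_trunc_le N _).trans ?_
      rw [norm_diag]
      exact mul_le_mul_of_nonneg_left hi gauge_one_pos.le
  have hsum : Summable fun i => D.kNorm i x • D.w i := by
    refine summable_of_isWeaklySequentiallyComplete hW (R := D.gauge 1 * R) fun A θ => ?_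
    refine le_trans (le_of_eq ?_) ((le_unconditionalNorm (D.diagTrunc (A.sup id + 1) x).2 A θ).trans
      (hbound _))
    congr 1
    refine Finset.sum_congr rfl fun i hi => ?_
    have h1 : i < A.sup id + 1 := Nat.lt_succ_of_le (Finset.le_sup (f := id) hi)
    rw [diagTrunc_apply, if_pos h1]
  exact ⟨(⟨x.1, kFun_lt_top x, hsum⟩ : D.submodule), rfl⟩

/-- If `W` is reflexive, then functionals on `D.SeqSpace` are small on far tails. -/
lemma exists_abs_apply_sub_trunc_le (hW : IsReflexive W) (φ : StrongDual ℝ D.SeqSpace) {δ : ℝ}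
    (hδ : 0 < δ) : ∃ N, ∀ x, |φ (x - SeqSpace.trunc D N x)| ≤ δ * ‖x‖ := by
  by_contra! hcon
  have hex : ∀ N, ∃ x : D.SeqSpace, ‖x‖ ≤ 1 ∧ δ ≤ φ (x - SeqSpace.trunc D N x) := fun N => by
    obtain ⟨x, hx⟩ := hcon N
    have hx0 : 0 < ‖x‖ := by
      rw [norm_pos_iff]
      rintro rfl
      simp at hx
    have key : ∀ s : ℝ, |s| = 1 → s * φ (x - SeqSpace.trunc D N x) =
        |φ (x - SeqSpace.trunc D N x)| → ∃ x : D.SeqSpace, ‖x‖ ≤ 1 ∧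
          δ ≤ φ (x - SeqSpace.trunc D N x) := fun s hs hsφ => by
      refine ⟨(s * ‖x‖⁻¹) • x, ?_, ?_⟩
      · rw [norm_smul, norm_mul, Real.norm_eq_abs, hs, one_mul, norm_inv, norm_norm,
          inv_mul_cancel₀ hx0.ne']
      · rw [map_smul, ← smul_sub, map_smul, smul_eq_mul, mul_right_comm, hsφ,
          ← div_eq_mul_inv, le_div_iff₀ hx0]
        exact hx.le
    rcases abs_cases (φ (x - SeqSpace.trunc D N x)) with h | h
    · exact key 1 (by simp) (by rw [h.1, one_mul])
    · exact key (-1) (by simp) (by rw [h.1, neg_one_mul])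
  choose x hx1 hxφ using hex
  set y : ℕ → D.SeqSpace := fun N => x N - SeqSpace.trunc D N (x N) with hy
  let u : ℕ → W := fun N => ∑' i, D.kNorm i ((y N).1 i) • D.w i
  have hu1 : ∀ N, ‖u N‖ ≤ 1 := fun N =>
    (norm_tsum_le_unconditionalNorm (y N).2).trans ((norm_sub_trunc_le N (x N)).trans (hx1 N))
  have hcoord : ∀ N i, D.w.coord i (u N) = D.kNorm i ((y N).1 i) := fun N i => by
    rw [(D.w.coord i).map_tsum (y N).2, tsum_eq_single i]
    · simp [D.w.ortho]
    · intro j hj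
      simp [D.w.ortho, hj.symm]
  -- The vectors `u N` are weakly null in `W` and lie in `V`, so Mazur's lemma puts `0` in the
  -- closure of `V`. A small `v'` in `V` dominates some `x'` of small norm with `φ x' ≥ δ`, a
  -- contradiction. Domination replaces equality because `k` is only subadditive; this makes `V`
  -- convex.
  let V : Set W := {v | ∃ x : D.SeqSpace, δ ≤ φ x ∧ ∀ i, D.kNorm i (x.1 i) ≤ D.w.coord i v}
  have hV : Convex ℝ V := by
    rintro v ⟨x, hx, hxv⟩ v' ⟨x', hx', hxv'⟩ a b ha hb hab
    refine ⟨a • x + b • x', ?_, fun i => ?_⟩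
    · rw [map_add, map_smul, map_smul, smul_eq_mul, smul_eq_mul]
      calc δ = a * δ + b * δ := by rw [← add_mul, hab, one_mul]
        _ ≤ _ := by gcongr
    · rw [SeqSpace.add_apply, SeqSpace.smul_apply, SeqSpace.smul_apply, map_add, map_smul,
        map_smul, smul_eq_mul, smul_eq_mul]
      refine (kNorm_add_le i _ _).trans ?_
      rw [kNorm_smul, kNorm_smul, abs_of_nonneg ha, abs_of_nonneg hb]
      gcongr
      · exact hxv i
      · exact hxv' i
  obtain ⟨v, hv⟩ := (hW.relWeaklyCompact (A := range u) (R := 1)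
    (by rintro _ ⟨N, rfl⟩; exact hu1 N)).exists_weakLim (hyperfilter ℕ) (u := u)
    (Eventually.of_forall fun N => ⟨N, rfl⟩)
  have hv0 : v = 0 := by
    have h1 : ∀ i, D.w.coord i v = 0 := fun i => by
      refine tendsto_nhds_unique (hv (D.w.coord i)) (Tendsto.mono_left ?_
        Nat.hyperfilter_le_atTop)
      refine tendsto_const_nhds.congr' ?_
      filter_upwards [eventually_gt_atTop i] with N hN
      rw [hcoord, hy, SeqSpace.sub_apply, SeqSpace.trunc_apply, if_pos hN, sub_self, kNorm_zero]
    have h2 := D.w.expansion v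
    simp only [h1, zero_smul] at h2
    exact h2.unique hasSum_zero
  have h0 : (0 : W) ∈ closure V := hv0 ▸ hv.mem_of_convex_closed hV.closure isClosed_closure
    (Eventually.of_forall fun N => subset_closure ⟨y N, hxφ N, fun i => (hcoord N i).ge⟩)
  obtain ⟨C, hC⟩ := exists_unconditionalNorm_le (w := D.w)
  have hpos : 0 < ‖φ‖ * |C| + 1 := by positivity
  obtain ⟨v', ⟨x', hx', hxv'⟩, hd⟩ := Metric.mem_closure_iff.1 h0 _ (div_pos hδ hpos)
  rw [dist_zero_left, lt_div_iff₀ hpos] at hd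
  have hexp := D.w.expansion v'
  have h3 : ‖x'‖ ≤ |C| * ‖v'‖ := by
    calc ‖x'‖ ≤ unconditionalNorm D.w fun i => D.w.coord i v' :=
          unconditionalNorm_mono hexp.summable fun i => by
            rw [abs_of_nonneg (kNorm_nonneg _ _)]
            exact (hxv' i).trans (le_abs_self _)
      _ ≤ C * ‖v'‖ := by
          have := hC _ hexp.summable
          rwa [hexp.tsum_eq] at this
      _ ≤ |C| * ‖v'‖ := by gcongr; exact le_abs_self C
  have h4 : φ x' ≤ ‖φ‖ * (|C| * ‖v'‖) :=
    (le_abs_self _).trans ((φ.le_opNorm x').trans (by gcongr))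
  nlinarith [norm_nonneg v']

lemma isReflexive_space (hW : IsReflexive W) : IsReflexive D.Space := by
  refine isReflexive_of_relWeaklyCompact fun R U hU => ?_
  obtain ⟨x, hx⟩ := (relWeaklyCompact_image_toE (D := D) R).exists_weakLim U (u := D.toE)
    (mem_of_superset hU fun f hf => ⟨f, hf, rfl⟩)
  have hball : ∀ᶠ f in (U : Filter D.Space), ‖f‖ ≤ R :=
    mem_of_superset hU fun f hf => by simpa using hf
  obtain ⟨f, rfl⟩ := exists_toE_eq_of_weakLim hW.isWeaklySequentiallyComplete (u := id) hball hx
  refine ⟨f, fun φ => ?_⟩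
  obtain ⟨ψ, hψ⟩ := exists_extension_diag φ
  rw [Metric.tendsto_nhds]
  intro ε hε
  have hg := gauge_one_pos (D := D)
  -- The tail errors of `g` and `f` and the head difference together stay below `(ε / 2 / B) * B = ε
  -- / 2`.
  set B := D.gauge 1 * |R| + D.gauge 1 * ‖f‖ + 1 with hB
  have hBpos : 0 < B := by positivity
  obtain ⟨N, hN⟩ := exists_abs_apply_sub_trunc_le hW ψ (δ := ε / 2 / B) (by positivity)
  have htail : ∀ g : D.Space,
      |φ g - ψ (D.diagTrunc N (D.toE g))| ≤ ε / 2 / B * (D.gauge 1 * ‖g‖) := fun g => by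
    rw [← hψ, ← trunc_diag, ← map_sub, ← norm_diag]
    exact hN _
  filter_upwards [hball, Metric.tendsto_nhds.1 (hx (ψ.comp (D.diagTrunc N))) (ε / 2 / B)
    (by positivity)] with g hg1 hg2
  rw [Real.dist_eq] at hg2 ⊢
  simp only [ContinuousLinearMap.comp_apply] at hg2
  have h1 := htail g
  have h2 := htail f
  have h3 : ε / 2 / B * (D.gauge 1 * ‖g‖) ≤ ε / 2 / B * (D.gauge 1 * |R|) := by
    gcongr
    exact hg1.trans (le_abs_self R)
  have h4 : ε / 2 / B * B = ε / 2 := div_mul_cancel₀ _ hBpos.ne'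
  have h5 : ε / 2 / B * B = ε / 2 / B * (D.gauge 1 * |R|) + ε / 2 / B * (D.gauge 1 * ‖f‖) +
      ε / 2 / B := by rw [hB]; ring
  simp only [id]
  calc |φ g - φ f| = |(φ g - ψ (D.diagTrunc N (D.toE g))) + (ψ (D.diagTrunc N (D.toE g)) -
        ψ (D.diagTrunc N (D.toE f))) + -(φ f - ψ (D.diagTrunc N (D.toE f)))| := by
        congr 1; ring
    _ ≤ |φ g - ψ (D.diagTrunc N (D.toE g))| + |ψ (D.diagTrunc N (D.toE g)) -
        ψ (D.diagTrunc N (D.toE f))| + |-(φ f - ψ (D.diagTrunc N (D.toE f)))| := abs_add_three _ _ _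
    _ < ε := by rw [abs_neg]; linarith

/-- Uniform smallness of tails of functionals was derived from reflexivity. Here convex combinations
that are norm null in `E` take its place, so that the heads vanish and the gliding hump handles the
tails. -/
lemma isWeaklySequentiallyComplete_space (hW : IsWeaklySequentiallyComplete W) :
    IsWeaklySequentiallyComplete D.Space := by
  intro u hu
  obtain ⟨R, hR⟩ := exists_norm_le_of_weakly_cauchy hu
  obtain ⟨x, hx⟩ := (relWeaklyCompact_image_toE (D := D) R).exists_weakLim (hyperfilter ℕ)
    (u := fun n => D.toE (u n))
    (Eventually.of_forall fun n => ⟨u n, by simpa using hR n, rfl⟩)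
  replace hx := weakLim_of_cauchy_of_weakLim (fun φ => hu (φ.comp D.toE))
    Nat.hyperfilter_le_atTop hx
  obtain ⟨f, rfl⟩ := exists_toE_eq_of_weakLim hW (Eventually.of_forall hR) hx
  refine ⟨f, fun φ => ?_⟩
  have hnull : WeakLim atTop (fun n => D.toE (u n - f)) 0 := fun χ => by
    simpa using (hx χ).sub_const (χ (D.toE f))
  -- The combinations are formed in `K` from tails of `u n - f`, so each functional has the same
  -- limit along `z` as along `u n - f`.
  have hz : ∀ m : ℕ, ∃ z ∈ convexHull ℝ ((fun n => u n - f) '' Ici m),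
      ‖D.toE z‖ < 1 / ((m : ℝ) + 1) := fun m => by
    obtain ⟨z, hz, hzn⟩ := hnull.exists_convexHull_norm_lt (Ici_mem_atTop m)
      (ε := 1 / ((m : ℝ) + 1)) (by positivity)
    have himg := D.toE.toLinearMap.image_convexHull ((fun n => u n - f) '' Ici m)
    rw [image_image] at himg
    rw [show (fun n => D.toE (u n - f)) = fun n => D.toE.toLinearMap (u n - f) from rfl,
      ← himg] at hz
    obtain ⟨z', hz', rfl⟩ := hz
    exact ⟨z', hz', hzn⟩
  choose z hzmem hzn using hz
  have hzlim : ∀ χ : StrongDual ℝ D.Space, ∃ c, Tendsto (fun n => χ (u n)) atTop (𝓝 c) ∧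
      Tendsto (fun m => χ (z m)) atTop (𝓝 (c - χ f)) := fun χ => by
    obtain ⟨c, hc⟩ := cauchySeq_tendsto_of_complete (hu χ)
    refine ⟨c, hc, tendsto_of_mem_convexHull_tail hzmem χ ?_⟩
    simpa using hc.sub_const (χ f)
  obtain ⟨ψ, hψ⟩ := exists_extension_diag φ
  have hz0 : Tendsto (fun m => D.toE (z m)) atTop (𝓝 0) :=
    squeeze_zero_norm (fun m => (hzn m).le) tendsto_one_div_add_atTop_nhds_zero_nat
  have hweak : WeakLim atTop (fun m => D.diag (z m)) 0 :=
    SeqSpace.weakLim_zero_of_trunc (fun N => by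
      simp only [trunc_diag]
      simpa using (((D.diagTrunc N).continuous.tendsto 0).comp hz0).norm)
      fun χ => by
        obtain ⟨c, -, hc⟩ := hzlim (χ.comp D.diag)
        exact hc.cauchySeq
  obtain ⟨c, hc, hcz⟩ := hzlim φ
  have h1 := hweak ψ
  simp only [hψ, map_zero] at h1
  have h2 : c = φ f := sub_eq_zero.1 (tendsto_nhds_unique hcz h1)
  exact h2 ▸ hc

end PeetreData

end

theorem corollary1 {W : Type*} [NormedAddCommGroup W] [NormedSpace ℝ W] [CompleteSpace W]
    (D : PeetreData W) :
    (IsReflexive W → IsReflexive D.Space) ∧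
      (IsWeaklySequentiallyComplete W → IsWeaklySequentiallyComplete D.Space) :=
  ⟨PeetreData.isReflexive_space, PeetreData.isWeaklySequentiallyComplete_space⟩
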